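/- Let $\lambda_b,\lambda_u,\lambda_l,\mu_b>0$, $p>0$, $T>0$ and $\alpha>2$. Let $\Phi_b$ (planar base stations) and $\Phi_u$ (planar users) be homogeneous Poisson point processes on $\mathbb R^2$ with intensities $\lambda_b,\lambda_u$, and let $\Xi$ be a Poisson point process on $\mathbb R\times[0,\pi)$ with intensity measure $\frac{\lambda_l}{\pi}\,dr\,d\theta$, a point $(r_i,\theta_i)$ of which represents the line $\{x\cos\theta_i+y\sin\theta_i=r_i\}$. On each of these lines place an independent homogeneous Poisson point process with intensity $\mu_b$, and let $\Psi_b$ (vehicular base stations) be the union of these points over all lines. Each base station $X\in\Phi_b+\Psi_b$ carries a fading variable $H_X$, exponential with mean one. The processes $\Phi_b,\Phi_u,\Xi$, the processes on the lines and the fading variables are all independent, and $\Phi_u$, $\Phi_b$ and $\Psi_b$ (the latter two with their fading marks) are compatible with the measurable, probability-preserving flow $(\theta_t)_{t\in\mathbb R^2}$ of a stationary framework, where $\theta_t$ translates the points by $-t$. Let $\mathbf P^0_{\Phi_u}$ be the Palm probability of $\Phi_u$, let $X_\star=\operatorname{argmin}_{X\in\Phi_b+\Psi_b}\|X\|$ be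 the base station nearest to the origin, and let $$\mathrm{SINR}=\frac{p\,H_{X_\star}\|X_\star\|^{-\alpha}}{\sum_{X\in\Phi_b+\Psi_b,\,X\ne X_\star}p\,H_X\|X\|^{-\alpha}}$$ (noise is neglected). Then $$\mathbf P^0_{\Phi_u}(\mathrm{SINR}>T,\;X_\star\in\Phi_b)=\int_0^\infty 2\pi\lambda_b r\,e^{-\pi\lambda_b r^2}\,e^{-2\pi\lambda_b\int_r^\infty\frac{Tr^\alpha u^{1-\alpha}}{1+Tr^\alpha u^{-\alpha}}\,du}\;e^{-2\lambda_l\int_r^\infty A_r(v)\,dv}\;e^{-2\lambda_l\int_0^r B_r(v)\,dv}\,dr,$$ where, with $g_r(v,u)=\frac{Tr^\alpha(v^2+u^2)^{-\alpha/2}}{1+Tr^\alpha(v^2+u^2)^{-\alpha/2}}$, $$A_r(v)=1-e^{-2\mu_b\int_0^\infty g_r(v,u)\,du},\qquad B_r(v)=1-e^{-2\mu_b\sqrt{r^2-v^2}-2\mu_b\int_{\sqrt{r^2-v^2}}^\infty g_r(v,u)\,du},$$ and all the integrals converge. -/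

import Mathlib

open MeasureTheory ProbabilityTheory Set

noncomputable section

namespace CoxCellular

/-- The Euclidean plane. -/
abbrev Plane := EuclideanSpace ℝ (Fin 2)

/-- The counting measure `∑ i, δ_{X i ω}` of a random sequence of points. -/
def counting {Ω E : Type*} [MeasurableSpace E] (X : ℕ → Ω → E) (ω : Ω) : Measure E :=
  Measure.sum fun i => Measure.dirac (X i ω)

/-- The random points `X 0, X 1, …` form a Poisson point process on `E` with intensity measure
`Λ`: counts in sets of finite intensity are Poisson variables, and counts in disjoint sets are
independent. -/
structure IsPoissonProcess {Ω E : Type*} [MeasurableSpace Ω] [MeasurableSpace E]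
    (P : Measure Ω) (X : ℕ → Ω → E) (Λ : Measure E) : Prop where
  measurable : ∀ i, Measurable (X i)
  law : ∀ B : Set E, MeasurableSet B → Λ B ≠ ⊤ → ∀ k : ℕ,
    P {ω | counting X ω B = (k : ENNReal)} = poissonMeasure (Λ B).toNNReal {k}
  indep : ∀ (n : ℕ) (B : Fin n → Set E), (∀ i, MeasurableSet (B i)) →
    (∀ i, Λ (B i) ≠ ⊤) → Pairwise (fun i j => Disjoint (B i) (B j)) →
    iIndepFun (fun i ω => counting X ω (B i)) P

/-- `(Ω, P, θ)` is a stationary framework: a measurable flow of the plane that preserves `P`. -/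
structure IsStationaryFlow {Ω : Type*} [MeasurableSpace Ω] (P : Measure Ω)
    (θ : Plane → Ω → Ω) : Prop where
  measurable : Measurable (fun q : Plane × Ω => θ q.1 q.2)
  zero : ∀ ω, θ 0 ω = ω
  add : ∀ s t ω, θ (s + t) ω = θ s (θ t ω)
  preserving : ∀ t, MeasurePreserving (θ t) P P

/-- The half-open unit square. -/
def unitSquare : Set Plane := {x | ∀ i, x i ∈ Ico (0 : ℝ) 1}

/-- The mean number of points in the unit square. -/
def meanIntensity {Ω : Type*} [MeasurableSpace Ω] (P : Measure Ω) (U : ℕ → Ω → Plane) :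
    ENNReal :=
  ∫⁻ ω, counting U ω unitSquare ∂P

/-- The Palm probability of the point process `∑ k, δ_{U k}` on a stationary framework:
`A ↦ λ⁻¹ E[∑ k, 1{U k ∈ [0,1)²} 1{θ_{U k} ω ∈ A}]`, where `λ` is the intensity. -/
def palm {Ω : Type*} [MeasurableSpace Ω] (P : Measure Ω) (θ : Plane → Ω → Ω)
    (U : ℕ → Ω → Plane) : Measure Ω :=
  (meanIntensity P U)⁻¹ •
    Measure.sum fun k =>
      (P.restrict {ω | U k ω ∈ unitSquare}).map (fun ω => θ (U k ω) ω)

/-- The point with signed coordinate `t`, measured from the foot of the perpendicular from the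
origin, on the line `{(x, y) | x cos φ + y sin φ = r}`, where `l = (r, φ)`. -/
def linePoint (l : ℝ × ℝ) (t : ℝ) : Plane :=
  !₂[l.1 * Real.cos l.2 - t * Real.sin l.2, l.1 * Real.sin l.2 + t * Real.cos l.2]

/-- Labels of base stations: `Sum.inl i` is the `i`-th planar base station, `Sum.inr (i, j)` the
`j`-th vehicular base station on the `i`-th line. -/
abbrev Station := ℕ ⊕ (ℕ × ℕ)

/-- The random elements of the network: planar users, planar base stations, lines `(r, φ)`,
coordinates of the vehicular base stations on each line, and the fading of each base station. -/
structure Network (Ω : Type*) where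
  user : ℕ → Ω → Plane
  planar : ℕ → Ω → Plane
  line : ℕ → Ω → ℝ × ℝ
  coord : ℕ → ℕ → Ω → ℝ
  fading : Station → Ω → ℝ

/-- The location of a base station. -/
def Network.pos {Ω : Type*} (N : Network Ω) : Station → Ω → Plane
  | Sum.inl i, ω => N.planar i ω
  | Sum.inr q, ω => linePoint (N.line q.1 ω) (N.coord q.1 q.2 ω)

/-- Labels of the independent sources of randomness. -/
inductive Source where
  | users
  | planar
  | lines
  | onLine (i : ℕ)
  | fading (s : Station)

/-- The σ-algebra generated by a source of randomness. -/
@[reducible] def Network.sigma {Ω : Type*} (N : Network Ω) : Source → MeasurableSpace Ω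
  | Source.users => ⨆ k, MeasurableSpace.comap (N.user k) inferInstance
  | Source.planar => ⨆ i, MeasurableSpace.comap (N.planar i) inferInstance
  | Source.lines => ⨆ i, MeasurableSpace.comap (N.line i) inferInstance
  | Source.onLine i => ⨆ j, MeasurableSpace.comap (N.coord i j) inferInstance
  | Source.fading s => MeasurableSpace.comap (N.fading s) inferInstance

/-- The law of the network: independent homogeneous Poisson users and planar base stations, an
isotropic Poisson line process with intensity `(lamL / π) dr dφ` on `ℝ × [0, π)`, independent
Poisson processes of intensity `muB` on the lines, and independent exponential fading with mean
one. -/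
structure Network.HasModelLaw {Ω : Type*} [MeasurableSpace Ω] (N : Network Ω) (P : Measure Ω)
    (lamB lamU lamL muB : ℝ) : Prop where
  user : IsPoissonProcess P N.user (ENNReal.ofReal lamU • volume)
  planar : IsPoissonProcess P N.planar (ENNReal.ofReal lamB • volume)
  line : IsPoissonProcess P N.line
    (ENNReal.ofReal (lamL / Real.pi) • volume.restrict (univ ×ˢ Ico 0 Real.pi))
  coord : ∀ i, IsPoissonProcess P (N.coord i) (ENNReal.ofReal muB • volume)
  fading_measurable : ∀ s, Measurable (N.fading s)
  fading_law : ∀ s, P.map (N.fading s) = expMeasure 1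
  indep : iIndep N.sigma P

/-- The users, the planar base stations and the vehicular base stations (each base station
together with its fading) are compatible with the flow: up to a relabelling of the points,
`θ t` translates each of these point processes by `-t`. -/
structure Network.IsCompatible {Ω : Type*} (N : Network Ω) (θ : Plane → Ω → Ω) : Prop where
  user : ∀ t ω, ∃ σ : Equiv.Perm ℕ, ∀ k, N.user (σ k) (θ t ω) = N.user k ω - t
  planar : ∀ t ω, ∃ σ : Equiv.Perm ℕ, ∀ i,
    N.pos (Sum.inl (σ i)) (θ t ω) = N.pos (Sum.inl i) ω - t ∧
    N.fading (Sum.inl (σ i)) (θ t ω) = N.fading (Sum.inl i) ω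
  vehicular : ∀ t ω, ∃ σ : Equiv.Perm (ℕ × ℕ), ∀ q,
    N.pos (Sum.inr (σ q)) (θ t ω) = N.pos (Sum.inr q) ω - t ∧
    N.fading (Sum.inr (σ q)) (θ t ω) = N.fading (Sum.inr q) ω

/-- The power `p H ‖x‖ ^ (-α)` received at the origin from a base station. -/
def Network.power {Ω : Type*} (N : Network Ω) (p α : ℝ) (s : Station) (ω : Ω) : ENNReal :=
  ENNReal.ofReal p * ENNReal.ofReal (N.fading s ω) * ‖N.pos s ω‖ₑ ^ (-α)

/-- The ratio, at the origin, of the power received from base station `s` to the total power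
received from all other base stations (noise is neglected). -/
def Network.sinr {Ω : Type*} (N : Network Ω) (p α : ℝ) (s : Station) (ω : Ω) : ENNReal :=
  N.power p α s ω / ∑' s' : {s' : Station // s' ≠ s}, N.power p α s'.1 ω

/-- The base station `s` is nearest to the origin among all base stations. -/
def Network.IsNearest {Ω : Type*} (N : Network Ω) (s : Station) (ω : Ω) : Prop :=
  ∀ s', ‖N.pos s ω‖ ≤ ‖N.pos s' ω‖

/-- The event that the nearest base station is planar and the SINR at the origin, when served by
it, exceeds `T`. -/
def Network.coveredByPlanar {Ω : Type*} (N : Network Ω) (p α T : ℝ) : Set Ω :=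
  {ω | ∃ i : ℕ, N.IsNearest (Sum.inl i) ω ∧ ENNReal.ofReal T < N.sinr p α (Sum.inl i) ω}

/-- `T r^α u^(1-α) / (1 + T r^α u^(-α))`. -/
def planarTerm (T α r u : ℝ) : ℝ :=
  T * r ^ α * u ^ (1 - α) / (1 + T * r ^ α * u ^ (-α))

/-- `T r^α (v² + u²)^(-α/2) / (1 + T r^α (v² + u²)^(-α/2))`. -/
def lineTerm (T α r v u : ℝ) : ℝ :=
  T * r ^ α * (v ^ 2 + u ^ 2) ^ (-α / 2) / (1 + T * r ^ α * (v ^ 2 + u ^ 2) ^ (-α / 2))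

/-- One minus the mean interference factor of a line at distance `v > r` from the origin. -/
def avoidTerm (muB T α r v : ℝ) : ℝ :=
  1 - Real.exp (-2 * muB * ∫ u in Ioi (0 : ℝ), lineTerm T α r v u)

/-- The analogue of `avoidTerm` for a line at distance `v < r` from the origin, including the
probability that it carries no base station in the ball of radius `r`. -/
def hitTerm (muB T α r v : ℝ) : ℝ :=
  1 - Real.exp (-2 * muB * Real.sqrt (r ^ 2 - v ^ 2)
    - 2 * muB * ∫ u in Ioi (Real.sqrt (r ^ 2 - v ^ 2)), lineTerm T α r v u)

/-- The integrand, as a function of the distance `r` to the serving base station. -/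
def coverageDensity (lamB lamL muB T α r : ℝ) : ℝ :=
  2 * Real.pi * lamB * r * Real.exp (-Real.pi * lamB * r ^ 2)
    * Real.exp (-2 * Real.pi * lamB * ∫ u in Ioi r, planarTerm T α r u)
    * Real.exp (-2 * lamL * ∫ v in Ioi r, avoidTerm muB T α r v)
    * Real.exp (-2 * lamL * ∫ v in Ioo 0 r, hitTerm muB T α r v)

end CoxCellular

end

/-! The users are independent of the base stations and their fading, and the flow preserves `P`
while moving the stations rigidly. Re-centring at a user therefore leaves the probability of
coverage unchanged, and the Palm probability of the event is its probability under `P`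
(`palm_coveredByPlanar`).

Under `P`, a planar station at distance r > 0 is nearest and covers the origin exactly when all
other stations X are at distance at least r and its fading H exceeds the sum of T r^α H_X ‖X‖^(-α).
Giving an infinite mark to every station closer than r merges both conditions into `shot < H`. As H
is exponential with mean one and independent of the rest, this has probability E e^{-shot};
averaging each other fading replaces `mark` by `loss`, where e^{-loss} is 1 / (1 + T r^α ρ^(-α)) at
distance ρ ≥ r and 0 inside the ball. The expected result is the integral of 2π λ_b r `laplace r`,
as the Campbell-Mecke formula would give.

This integral is obtained by discretization. The plane is cut into annuli of equal area πδ. For a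
station in one annulus, coverage is implied by the strict inequality with the outer radius and
implies the weak one with the inner radius. Counts in an annulus are independent of the stations
outside it, so `sum_measure_serving_le` and `le_sum_measure_serving` bound each annulus by its
intensity times `laplace` at the inner or outer radius, up to a factor tending to 1. `laplace`
decreases with the radius, so these are Riemann sums in t = r², and
`eq_mul_lintegral_of_riemann_bounds` passes to the limit.

Finally `laplace` is computed by the exponential formula for Poisson processes: in the plane for the
planar stations; for the Cox process, first on each line given the lines, then for the line process
(`vehicularLaplace_eq`). The infinite loss inside the ball produces the void factor e^{-π λ_b r²}
and the square root in `hitTerm`. -/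

noncomputable section

namespace CoxCellular

open Filter Topology

/-! ### The exponential `x ↦ e⁻ˣ` on `[0, ∞]` -/

/-- `e⁻ˣ` for `x ∈ [0, ∞]`, with `e^{-∞} = 0`. -/
def expNeg (x : ENNReal) : ENNReal := EReal.exp (-(x : EReal))

@[simp] lemma expNeg_top : expNeg ⊤ = 0 := by simp [expNeg]

@[simp] lemma expNeg_zero : expNeg 0 = 1 := by simp [expNeg]

lemma expNeg_ofReal {x : ℝ} (hx : 0 ≤ x) :
    expNeg (ENNReal.ofReal x) = ENNReal.ofReal (Real.exp (-x)) := by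
  rw [expNeg, EReal.coe_ennreal_ofReal, max_eq_left hx, ← EReal.coe_neg, EReal.exp_coe]

lemma expNeg_coe (x : NNReal) : expNeg x = ENNReal.ofReal (Real.exp (-x)) := by
  rw [← ENNReal.ofReal_coe_nnreal, expNeg_ofReal x.coe_nonneg]

lemma expNeg_add (x y : ENNReal) : expNeg (x + y) = expNeg x * expNeg y := by
  induction x with
  | top => simp
  | coe x =>
    induction y with
    | top => simp
    | coe y =>
      rw [← ENNReal.coe_add, expNeg_coe, expNeg_coe, expNeg_coe,
        ← ENNReal.ofReal_mul (Real.exp_nonneg _), ← Real.exp_add]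
      congr 2
      push_cast
      ring

lemma expNeg_antitone : Antitone expNeg := fun x y h =>
  EReal.exp_monotone (by simpa [EReal.neg_le_neg_iff] using h)

lemma expNeg_le_one (x : ENNReal) : expNeg x ≤ 1 := by
  simpa using expNeg_antitone (zero_le : 0 ≤ x)

lemma expNeg_ne_top (x : ENNReal) : expNeg x ≠ ⊤ :=
  ne_top_of_le_ne_top ENNReal.one_ne_top (expNeg_le_one x)

lemma continuous_expNeg : Continuous expNeg :=
  ENNReal.continuous_exp.comp (continuous_neg.comp continuous_coe_ennreal_ereal)

@[fun_prop]
lemma measurable_expNeg : Measurable expNeg := continuous_expNeg.measurable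

lemma expNeg_sum {ι : Type*} (s : Finset ι) (f : ι → ENNReal) :
    expNeg (∑ i ∈ s, f i) = ∏ i ∈ s, expNeg (f i) := by
  classical
  induction s using Finset.induction_on with
  | empty => simp
  | insert a s ha ih => rw [Finset.sum_insert ha, Finset.prod_insert ha, expNeg_add, ih]

lemma expNeg_mul_natCast (x : ENNReal) (n : ℕ) : expNeg (x * n) = expNeg x ^ n := by
  induction n with
  | zero => simp
  | succ n ih => rw [Nat.cast_succ, mul_add, expNeg_add, ih, mul_one, pow_succ]

/-! ### Counts of a Poisson process -/

lemma tsum_poissonMeasure (r : NNReal) : ∑' k, poissonMeasure r {k} = 1 := by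
  have := lintegral_countable' (μ := poissonMeasure r) (fun _ => 1)
  simpa using this.symm

lemma tsum_natCast_mul_poissonMeasure (r : NNReal) :
    ∑' k : ℕ, (k : ENNReal) * poissonMeasure r {k} = r := by
  rw [tsum_eq_zero_add' ENNReal.summable]
  have h : ∀ k : ℕ, ((k + 1 : ℕ) : ENNReal) * poissonMeasure r {k + 1}
      = r * poissonMeasure r {k} := by
    intro k
    rw [poissonMeasure_singleton, poissonMeasure_singleton, ← ENNReal.ofReal_natCast,
      ← ENNReal.ofReal_mul (by positivity), ← ENNReal.ofReal_coe_nnreal (p := r),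
      ← ENNReal.ofReal_mul (by positivity)]
    congr 1
    rw [Nat.factorial_succ]
    push_cast
    field_simp
    ring
  simp_rw [h]
  rw [ENNReal.tsum_mul_left, tsum_poissonMeasure]
  simp

/-- The Poisson generating function E y^N = e^{-r(1-y)} at y = e^{-c}. The value c = ∞ is allowed
and gives the void probability. -/
lemma tsum_expNeg_mul_poissonMeasure (r : NNReal) (c : ENNReal) :
    ∑' k : ℕ, expNeg (c * k) * poissonMeasure r {k} = expNeg (r * (1 - expNeg c)) := by
  obtain ⟨y, hy⟩ : ∃ y : NNReal, (y : ENNReal) = expNeg c :=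
    ⟨_, ENNReal.coe_toNNReal (expNeg_ne_top c)⟩
  have hy1 : (y : ℝ) ≤ 1 := by
    have := expNeg_le_one c
    rw [← hy] at this
    exact_mod_cast this
  have hterm : ∀ k : ℕ, expNeg (c * k) * poissonMeasure r {k}
      = ENNReal.ofReal (Real.exp (-r) * ((r * y : ℝ) ^ k / k.factorial)) := by
    intro k
    rw [expNeg_mul_natCast, ← hy, poissonMeasure_singleton, ← ENNReal.ofReal_coe_nnreal (p := y),
      ← ENNReal.ofReal_pow y.coe_nonneg, ← ENNReal.ofReal_mul (by positivity)]
    congr 1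
    rw [mul_pow]
    ring
  have hs : HasSum (fun k : ℕ => Real.exp (-r) * ((r * y : ℝ) ^ k / k.factorial))
      (Real.exp (-r) * Real.exp (r * y)) := by
    have := NormedSpace.expSeries_div_hasSum_exp (r * y : ℝ)
    rw [← Real.exp_eq_exp_ℝ] at this
    exact this.mul_left _
  simp_rw [hterm]
  rw [← ENNReal.ofReal_tsum_of_nonneg (fun k => by positivity) hs.summable, hs.tsum_eq, ← hy,
    ← ENNReal.coe_one, ← ENNReal.coe_sub, ← ENNReal.coe_mul, expNeg_coe, ← Real.exp_add]
  congr 2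
  rw [NNReal.coe_mul, NNReal.coe_sub (by exact_mod_cast hy1)]
  push_cast
  ring

section Poisson

lemma lintegral_counting {Ω E : Type*} [MeasurableSpace E] (X : ℕ → Ω → E) (ω : Ω)
    {f : E → ENNReal} (hf : Measurable f) :
    ∫⁻ x, f x ∂counting X ω = ∑' i, f (X i ω) := by
  rw [counting, lintegral_sum_measure]
  exact tsum_congr fun i => lintegral_dirac' _ hf

lemma counting_apply {Ω E : Type*} [MeasurableSpace E] (X : ℕ → Ω → E) (ω : Ω)
    {B : Set E} (hB : MeasurableSet B) : counting X ω B = ∑' i, B.indicator 1 (X i ω) := by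
  rw [counting, Measure.sum_apply _ hB]
  exact tsum_congr fun i => Measure.dirac_apply' _ hB

variable {Ω E : Type*} [MeasurableSpace Ω] [MeasurableSpace E] {P : Measure Ω}
  {X : ℕ → Ω → E} {Λ : Measure E}

lemma measurable_counting (hX : ∀ i, Measurable (X i)) {B : Set E} (hB : MeasurableSet B) :
    Measurable fun ω => counting X ω B := by
  simp_rw [counting_apply X _ hB]
  exact Measurable.tsum fun i => (measurable_one.indicator hB).comp (hX i)

namespace IsPoissonProcess

lemma measure_count_eq_one (h : IsPoissonProcess P X Λ) {B : Set E} (hB : MeasurableSet B)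
    (hΛ : Λ B ≠ ⊤) :
    P {ω | counting X ω B = 1} = expNeg (Λ B) * Λ B := by
  have := h.law B hB hΛ 1
  rw [Nat.cast_one] at this
  rw [this, poissonMeasure_singleton]
  conv_rhs => rw [← ENNReal.coe_toNNReal hΛ]
  rw [expNeg_coe, ← ENNReal.ofReal_coe_nnreal (p := (Λ B).toNNReal),
    ← ENNReal.ofReal_mul (by positivity)]
  simp

lemma iIndepFun_counting (h : IsPoissonProcess P X Λ) {ι : Type*} [Fintype ι] (B : ι → Set E)
    (hB : ∀ i, MeasurableSet (B i)) (hΛ : ∀ i, Λ (B i) ≠ ⊤)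
    (hd : Pairwise fun i j => Disjoint (B i) (B j)) :
    iIndepFun (fun i ω => counting X ω (B i)) P := by
  let e := Fintype.equivFin ι
  have := h.indep (Fintype.card ι) (fun k => B (e.symm k)) (fun k => hB _) (fun k => hΛ _)
    (fun i j hij => hd (e.symm.injective.ne hij))
  simpa using this.precomp e.injective

variable [IsProbabilityMeasure P]

lemma lintegral_count (h : IsPoissonProcess P X Λ) {B : Set E} (hB : MeasurableSet B)
    (hΛ : Λ B ≠ ⊤) (g : ENNReal → ENNReal) :
    ∫⁻ ω, g (counting X ω B) ∂P
      = ∑' k : ℕ, g k * poissonMeasure (Λ B).toNNReal {k} := by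
  have hm := measurable_counting h.measurable hB
  let S : ℕ → Set Ω := fun k => {ω | counting X ω B = (k : ENNReal)}
  have hS : ∀ k, MeasurableSet (S k) := fun k => hm (measurableSet_singleton _)
  have hd : Pairwise (Function.onFun Disjoint S) := by
    intro i j hij
    refine Set.disjoint_left.mpr fun ω hi hj => hij ?_
    have : (i : ENNReal) = j := hi.symm.trans hj
    exact_mod_cast this
  -- The Poisson weights of the finite values already add up to one, so an infinite count has
  -- probability zero.
  have hU : P (⋃ k, S k) = 1 := by
    rw [measure_iUnion hd hS, ← tsum_poissonMeasure (Λ B).toNNReal]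
    exact tsum_congr fun k => h.law B hB hΛ k
  have hae : P.restrict (⋃ k, S k) = P := by
    refine Measure.restrict_eq_self_of_ae_mem ?_
    exact (mem_ae_iff_prob_eq_one (MeasurableSet.iUnion hS)).mpr hU
  rw [← hae, lintegral_iUnion hS hd]
  refine tsum_congr fun k => ?_
  rw [setLIntegral_congr_fun (g := fun _ => g k) (hS k) (fun ω hω => by
    have : counting X ω B = k := hω
    simp only [this])]
  rw [setLIntegral_const, ← h.law B hB hΛ k]

lemma lintegral_counting_eq (h : IsPoissonProcess P X Λ) {B : Set E} (hB : MeasurableSet B)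
    (hΛ : Λ B ≠ ⊤) : ∫⁻ ω, counting X ω B ∂P = Λ B := by
  rw [h.lintegral_count hB hΛ (fun x => x), tsum_natCast_mul_poissonMeasure,
    ENNReal.coe_toNNReal hΛ]

lemma lintegral_expNeg_count (h : IsPoissonProcess P X Λ) {B : Set E} (hB : MeasurableSet B)
    (hΛ : Λ B ≠ ⊤) (c : ENNReal) :
    ∫⁻ ω, expNeg (c * counting X ω B) ∂P = expNeg (Λ B * (1 - expNeg c)) := by
  rw [h.lintegral_count hB hΛ (fun x => expNeg (c * x)), tsum_expNeg_mul_poissonMeasure,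
    ENNReal.coe_toNNReal hΛ]

/-- A count and the integral of a simple function supported elsewhere are independent. -/
lemma lintegral_count_mul_expNeg_simpleFunc (h : IsPoissonProcess P X Λ) {B : Set E}
    (hB : MeasurableSet B) (hΛ : Λ B ≠ ⊤) (g : ENNReal → ENNReal) (hg : Measurable g)
    (f : SimpleFunc E ENNReal) (hf : ∀ x ∈ B, f x = 0) (hfin : ∀ c ≠ 0, Λ (f ⁻¹' {c}) ≠ ⊤) :
    ∫⁻ ω, g (counting X ω B) * expNeg (∫⁻ x, f x ∂counting X ω) ∂P
      = (∫⁻ ω, g (counting X ω B) ∂P) * expNeg (∫⁻ x, (1 - expNeg (f x)) ∂Λ) := by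
  classical
  -- The integral of `f` against the points is the sum of c times the count in the level set of c.
  -- The value 0 is left out: it contributes nothing and its level set may have infinite intensity.
  -- The remaining level sets and `B` are disjoint, so their counts are jointly independent.
  let R : Finset ENNReal := f.range.filter (· ≠ 0)
  let C : Option R → Set E := fun o => o.elim B fun c => f ⁻¹' {(c : ENNReal)}
  let G : Option R → ENNReal → ENNReal := fun o => o.elim g fun c x => expNeg ((c : ENNReal) * x)
  have hR : ∀ c : R, (c : ENNReal) ≠ 0 := fun c => (Finset.mem_filter.mp c.2).2
  have hC : ∀ o, MeasurableSet (C o) := by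
    rintro (_ | c)
    · exact hB
    · exact f.measurableSet_preimage _
  have hCΛ : ∀ o, Λ (C o) ≠ ⊤ := by
    rintro (_ | c)
    · exact hΛ
    · exact hfin _ (hR c)
  have hG : ∀ o, Measurable (G o) := by
    rintro (_ | c)
    · exact hg
    · exact measurable_expNeg.comp (measurable_const_mul _)
  have hCd : Pairwise fun i j => Disjoint (C i) (C j) := by
    have key : ∀ c : R, Disjoint B (f ⁻¹' {(c : ENNReal)}) := fun c =>
      Set.disjoint_left.mpr fun x hx hx' => hR c (by rw [← hf x hx]; exact hx'.symm)
    rintro (_ | c) (_ | d) hcd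
    · exact absurd rfl hcd
    · exact key d
    · exact (key c).symm
    · refine Set.disjoint_left.mpr fun x hx hx' => hcd ?_
      have : (c : ENNReal) = d := (show f x = c from hx).symm.trans hx'
      rw [Subtype.ext this]
  have hind := (h.iIndepFun_counting C hC hCΛ hCd).comp G hG
  have hprod := lintegral_prod_eq_prod_lintegral_of_indepFun Finset.univ _ hind
    fun o => (hG o).comp (measurable_counting h.measurable (hC o))
  have hsum : ∀ (μ : Measure E) (φ : ENNReal → ENNReal), φ 0 = 0 →
      ∫⁻ x, φ (f x) ∂μ = ∑ c : R, φ c * μ (f ⁻¹' {(c : ENNReal)}) := by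
    intro μ φ hφ
    have : ∫⁻ x, φ (f x) ∂μ = (f.map φ).lintegral μ := by
      rw [← SimpleFunc.lintegral_eq_lintegral]; rfl
    rw [this, SimpleFunc.map_lintegral, Finset.sum_coe_sort R fun c => φ c * μ (f ⁻¹' {c}),
      Finset.sum_filter]
    refine Finset.sum_congr rfl fun c _ => ?_
    by_cases hc : c = 0
    · simp [hc, hφ]
    · simp [hc]
  simp only [Fintype.prod_option, Function.comp_def] at hprod
  have e1 : ∀ ω, g (counting X ω B) * expNeg (∫⁻ x, f x ∂counting X ω)
      = G none (counting X ω (C none)) * ∏ c : R, G (some c) (counting X ω (C (some c))) := by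
    intro ω
    rw [hsum _ (fun x => x) rfl, expNeg_sum]
    rfl
  simp_rw [e1]
  rw [hprod, hsum Λ (fun x => 1 - expNeg x) (by simp), expNeg_sum]
  congr 1
  refine Finset.prod_congr rfl fun c _ => ?_
  rw [mul_comm (1 - _)]
  exact h.lintegral_expNeg_count (hC (some c)) (hCΛ (some c)) c

/-- A count and the integral of a function supported elsewhere are independent, and the Laplace
transform of the latter is given by the exponential formula. -/
lemma lintegral_count_mul_expNeg (h : IsPoissonProcess P X Λ) [SigmaFinite Λ] {B : Set E}
    (hB : MeasurableSet B) (hΛ : Λ B ≠ ⊤) (g : ENNReal → ENNReal) (hg : Measurable g)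
    (hgfin : ∫⁻ ω, g (counting X ω B) ∂P ≠ ⊤)
    {f : E → ENNReal} (hfm : Measurable f) (hf : ∀ x ∈ B, f x = 0) :
    ∫⁻ ω, g (counting X ω B) * expNeg (∑' i, f (X i ω)) ∂P
      = (∫⁻ ω, g (counting X ω B) ∂P) * expNeg (∫⁻ x, (1 - expNeg (f x)) ∂Λ) := by
  -- Restricting the n-th simple approximation to the n-th spanning set gives its nonzero level sets
  -- finite intensity, and keeps the sequence increasing to `f`.
  let F : ℕ → SimpleFunc E ENNReal := fun n =>
    (SimpleFunc.eapprox f n).restrict (spanningSets Λ n)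
  have hFa : ∀ n x, F n x = (spanningSets Λ n).indicator (SimpleFunc.eapprox f n) x := fun n x =>
    SimpleFunc.restrict_apply _ (measurableSet_spanningSets Λ n) x
  have hmono : ∀ x, Monotone fun n => F n x := by
    intro x m n hmn
    simp only [hFa]
    by_cases hx : x ∈ spanningSets Λ m
    · rw [indicator_of_mem hx, indicator_of_mem (monotone_spanningSets Λ hmn hx)]
      exact SimpleFunc.monotone_eapprox f hmn x
    · rw [indicator_of_notMem hx]
      exact zero_le
  have htend : ∀ x, Tendsto (fun n => F n x) atTop (𝓝 (f x)) := by
    intro x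
    have h1 : Tendsto (fun n => SimpleFunc.eapprox f n x) atTop (𝓝 (f x)) := by
      rw [← SimpleFunc.iSup_eapprox_apply hfm x]
      exact tendsto_atTop_iSup fun m n hmn => SimpleFunc.monotone_eapprox f hmn x
    refine h1.congr' ?_
    filter_upwards [eventually_ge_atTop (spanningSetsIndex Λ x)] with n hn
    rw [hFa, indicator_of_mem
      (monotone_spanningSets Λ hn (mem_spanningSetsIndex Λ x))]
  have hle : ∀ n x, F n x ≤ f x := fun n x => (hmono x).ge_of_tendsto (htend x) n
  have hstep : ∀ n, ∫⁻ ω, g (counting X ω B) * expNeg (∫⁻ x, F n x ∂counting X ω) ∂P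
      = (∫⁻ ω, g (counting X ω B) ∂P) * expNeg (∫⁻ x, (1 - expNeg (F n x)) ∂Λ) := by
    intro n
    refine h.lintegral_count_mul_expNeg_simpleFunc hB hΛ g hg (F n) ?_ ?_
    · intro x hx
      have := hle n x
      rw [hf x hx] at this
      exact le_antisymm this zero_le
    · intro c hc
      refine ne_top_of_le_ne_top (measure_spanningSets_lt_top Λ n).ne (measure_mono ?_)
      intro x hx
      by_contra hx'
      have : F n x = 0 := by rw [hFa, indicator_of_notMem hx']
      exact hc ((show F n x = c from hx).symm.trans this)
  have hl : Tendsto (fun n => ∫⁻ ω, g (counting X ω B) * expNeg (∫⁻ x, F n x ∂counting X ω) ∂P)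
      atTop (𝓝 (∫⁻ ω, g (counting X ω B) * expNeg (∑' i, f (X i ω)) ∂P)) := by
    -- The integrands decrease with n, so this side needs domination by the integrable `g` of the
    -- count; the exponent on the other side increases and passes by monotone convergence.
    refine tendsto_lintegral_of_dominated_convergence (fun ω => g (counting X ω B)) ?_ ?_ hgfin ?_
    · intro n
      refine (hg.comp (measurable_counting h.measurable hB)).mul (measurable_expNeg.comp ?_)
      simp_rw [lintegral_counting X _ (F n).measurable]
      exact Measurable.tsum fun i => (F n).measurable.comp (h.measurable i)
    · exact fun n => ae_of_all _ fun ω => mul_le_of_le_one_right zero_le (expNeg_le_one _)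
    · filter_upwards [ae_lt_top (hg.comp (measurable_counting h.measurable hB)) hgfin] with ω hω
      refine ENNReal.Tendsto.const_mul ((continuous_expNeg.tendsto _).comp ?_) (Or.inr hω.ne)
      rw [← lintegral_counting X ω hfm]
      exact lintegral_tendsto_of_tendsto_of_monotone (fun n => (F n).measurable.aemeasurable)
        (ae_of_all _ hmono) (ae_of_all _ htend)
  have hr : Tendsto (fun n => (∫⁻ ω, g (counting X ω B) ∂P)
        * expNeg (∫⁻ x, (1 - expNeg (F n x)) ∂Λ)) atTop
      (𝓝 ((∫⁻ ω, g (counting X ω B) ∂P) * expNeg (∫⁻ x, (1 - expNeg (f x)) ∂Λ))) := by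
    refine ENNReal.Tendsto.const_mul ((continuous_expNeg.tendsto _).comp ?_) (Or.inr hgfin)
    refine lintegral_tendsto_of_tendsto_of_monotone
      (fun n => (measurable_const.sub
        (measurable_expNeg.comp (F n).measurable)).aemeasurable)
      (ae_of_all _ fun x m n hmn => tsub_le_tsub_left (expNeg_antitone (hmono x hmn)) 1)
      (ae_of_all _ fun x => ?_)
    exact (((ENNReal.continuous_sub_left ENNReal.one_ne_top).comp
      continuous_expNeg).tendsto _).comp (htend x)
  simp_rw [hstep] at hl
  exact tendsto_nhds_unique hl hr

/-- The Laplace functional of a Poisson process. -/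
lemma lintegral_expNeg_tsum (h : IsPoissonProcess P X Λ) [SigmaFinite Λ]
    {f : E → ENNReal} (hfm : Measurable f) :
    ∫⁻ ω, expNeg (∑' i, f (X i ω)) ∂P = expNeg (∫⁻ x, (1 - expNeg (f x)) ∂Λ) := by
  simpa using h.lintegral_count_mul_expNeg MeasurableSet.empty (by simp) (fun _ => 1)
    measurable_const (by simp) hfm (by simp)

end IsPoissonProcess

end Poisson

/-! ### Independence -/

section Independence

variable {Ω : Type*} [MeasurableSpace Ω] {P : Measure Ω} [IsProbabilityMeasure P]

/-- Conditioning on one of two independent random elements. -/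
lemma lintegral_of_indepFun {β γ : Type*} [MeasurableSpace β] [MeasurableSpace γ]
    {X : Ω → β} {Y : Ω → γ} (hX : Measurable X) (hY : Measurable Y) (h : IndepFun X Y P)
    {F : β → γ → ENNReal} (hF : Measurable fun q : β × γ => F q.1 q.2) :
    ∫⁻ ω, F (X ω) (Y ω) ∂P = ∫⁻ ω, ∫⁻ ω', F (X ω) (Y ω') ∂P ∂P := by
  have hp := h.map_prod_eq_prod_map_map hX.aemeasurable hY.aemeasurable
  have : IsProbabilityMeasure (P.map Y) := Measure.isProbabilityMeasure_map hY.aemeasurable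
  calc ∫⁻ ω, F (X ω) (Y ω) ∂P
      = ∫⁻ q, F q.1 q.2 ∂(P.map fun ω => (X ω, Y ω)) :=
        (lintegral_map hF (hX.prodMk hY)).symm
    _ = ∫⁻ x, ∫⁻ y, F x y ∂(P.map Y) ∂(P.map X) := by
        rw [hp, lintegral_prod _ hF.aemeasurable]
    _ = ∫⁻ ω, ∫⁻ y, F (X ω) y ∂(P.map Y) ∂P :=
        lintegral_map hF.lintegral_prod_right' hX
    _ = _ := lintegral_congr fun ω => lintegral_map (hF.comp measurable_prodMk_left) hY

/-- The Laplace transform of a countable sum of independent variables. -/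
lemma lintegral_expNeg_tsum_of_iIndepFun {ι : Type*} [Countable ι] {Y : ι → Ω → ENNReal}
    (hY : ∀ i, Measurable (Y i)) (h : iIndepFun Y P) (c : ι → ENNReal)
    (hc : ∀ i, ∫⁻ ω, expNeg (Y i ω) ∂P = expNeg (c i)) :
    ∫⁻ ω, expNeg (∑' i, Y i ω) ∂P = expNeg (∑' i, c i) := by
  have hl : Tendsto (fun s : Finset ι => ∫⁻ ω, expNeg (∑ i ∈ s, Y i ω) ∂P) atTop
      (𝓝 (∫⁻ ω, expNeg (∑' i, Y i ω) ∂P)) := by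
    refine tendsto_lintegral_filter_of_dominated_convergence (fun _ => 1) ?_ ?_ (by simp) ?_
    · exact Eventually.of_forall fun s =>
        measurable_expNeg.comp (Finset.measurable_fun_sum s fun i _ => hY i)
    · exact Eventually.of_forall fun s => ae_of_all _ fun ω => expNeg_le_one _
    · exact ae_of_all _ fun ω =>
        (continuous_expNeg.tendsto _).comp ENNReal.summable.hasSum
  have hr : Tendsto (fun s : Finset ι => expNeg (∑ i ∈ s, c i)) atTop
      (𝓝 (expNeg (∑' i, c i))) :=
    (continuous_expNeg.tendsto _).comp ENNReal.summable.hasSum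
  have he : ∀ s : Finset ι, ∫⁻ ω, expNeg (∑ i ∈ s, Y i ω) ∂P = expNeg (∑ i ∈ s, c i) := by
    intro s
    simp_rw [expNeg_sum]
    rw [lintegral_prod_eq_prod_lintegral_of_indepFun s (fun i ω => expNeg (Y i ω))
      (h.comp (fun _ => expNeg) fun _ => measurable_expNeg)
      fun i => measurable_expNeg.comp (hY i)]
    exact Finset.prod_congr rfl fun i _ => hc i
  simp_rw [he] at hl
  exact tendsto_nhds_unique hl hr

end Independence

/-! ### Exponential variables -/

/-- Tilting the exponential density of rate 1 by e^{-cx} gives (1 + c)⁻¹ times the exponential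
density of rate 1 + c, which has mass one. -/
lemma lintegral_expNeg_mul_expMeasure {c : ℝ} (hc : 0 ≤ c) :
    ∫⁻ x, expNeg (ENNReal.ofReal c * ENNReal.ofReal x) ∂expMeasure 1
      = ENNReal.ofReal (1 + c)⁻¹ := by
  have h1 : expMeasure 1 = volume.withDensity (exponentialPDF 1) := rfl
  have hpos : 0 < 1 + c := by linarith
  have hm : ∀ r, Measurable (exponentialPDF r) := fun r =>
    (measurable_exponentialPDFReal r).ennreal_ofReal
  have hg : Measurable fun x : ℝ => expNeg (ENNReal.ofReal c * ENNReal.ofReal x) :=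
    measurable_expNeg.comp (measurable_const.mul ENNReal.measurable_ofReal)
  rw [h1, lintegral_withDensity_eq_lintegral_mul _ (hm 1) hg]
  have h2 : ∀ x : ℝ, (exponentialPDF 1 * fun x => expNeg (ENNReal.ofReal c * ENNReal.ofReal x)) x
      = ENNReal.ofReal (1 + c)⁻¹ * exponentialPDF (1 + c) x := by
    intro x
    rw [Pi.mul_apply]
    rcases lt_or_ge x 0 with hx | hx
    · rw [exponentialPDF_of_neg hx, exponentialPDF_of_neg hx]; simp
    · rw [exponentialPDF_of_nonneg hx, exponentialPDF_of_nonneg hx, ← ENNReal.ofReal_mul hc,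
        expNeg_ofReal (mul_nonneg hc hx), ← ENNReal.ofReal_mul (by positivity),
        ← ENNReal.ofReal_mul (by positivity)]
      rw [← mul_assoc, inv_mul_cancel₀ hpos.ne', one_mul, one_mul, ← Real.exp_add]
      ring_nf
  rw [lintegral_congr h2, lintegral_const_mul _ (hm _), lintegral_exponentialPDF_eq_one hpos,
    mul_one]

lemma expMeasure_one_Ioi {y : ℝ} (hy : 0 ≤ y) :
    expMeasure 1 (Ioi y) = ENNReal.ofReal (Real.exp (-y)) := by
  have : IsProbabilityMeasure (expMeasure 1) := isProbabilityMeasure_expMeasure one_pos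
  have h := cdf_expMeasure_eq one_pos y
  rw [if_pos hy, cdf_eq_real] at h
  have hc : Ioi y = (Iic y)ᶜ := compl_Iic.symm
  rw [hc, ← ofReal_measureReal, probReal_compl_eq_one_sub measurableSet_Iic, h]
  simp

lemma expMeasure_one_Ici {y : ℝ} (hy : 0 ≤ y) :
    expMeasure 1 (Ici y) = ENNReal.ofReal (Real.exp (-y)) := by
  rw [← expMeasure_one_Ioi hy]
  have hac : expMeasure 1 ≪ volume := withDensity_absolutelyContinuous _ _
  exact measure_congr (hac.ae_eq Ioi_ae_eq_Ici).symm

lemma expMeasure_one_lt_ofReal (y : ENNReal) :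
    expMeasure 1 {x | y < ENNReal.ofReal x} = expNeg y := by
  induction y with
  | top => simp
  | coe y =>
    rw [expNeg_coe, ← expMeasure_one_Ioi y.coe_nonneg]
    congr 1
    ext x
    simp only [mem_ofPred_eq, mem_Ioi]
    rw [← ENNReal.ofReal_coe_nnreal, ENNReal.ofReal_lt_ofReal_iff']
    exact ⟨fun h => h.1, fun h => ⟨h, y.coe_nonneg.trans_lt h⟩⟩

lemma expMeasure_one_le_ofReal (y : ENNReal) :
    expMeasure 1 {x | y ≤ ENNReal.ofReal x} = expNeg y := by
  induction y with
  | top => simp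
  | coe y =>
    -- At y = 0 the set is the whole line, since negative x truncate to 0; for y > 0 it is the
    -- half-line from y.
    rcases eq_or_lt_of_le (zero_le : 0 ≤ y) with h0 | h0
    · have : IsProbabilityMeasure (expMeasure 1) := isProbabilityMeasure_expMeasure one_pos
      simp [← h0]
    · rw [expNeg_coe, ← expMeasure_one_Ici y.coe_nonneg]
      congr 1
      ext x
      simp only [mem_ofPred_eq, mem_Ici]
      rw [← ENNReal.ofReal_coe_nnreal]
      exact ENNReal.ofReal_le_ofReal_iff' |>.trans
        ⟨fun h => h.resolve_right (not_le.mpr (by exact_mod_cast h0)), Or.inl⟩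

/-! ### The sources of randomness of a network -/

lemma continuous_linePoint : Continuous fun q : (ℝ × ℝ) × ℝ => linePoint q.1 q.2 := by
  unfold linePoint
  refine (PiLp.continuous_toLp 2 _).comp (continuous_pi fun i => ?_)
  fin_cases i <;> simp <;> fun_prop

lemma norm_linePoint (l : ℝ × ℝ) (t : ℝ) : ‖linePoint l t‖ = Real.sqrt (l.1 ^ 2 + t ^ 2) := by
  rw [EuclideanSpace.norm_eq]
  congr 1
  simp only [linePoint, Fin.sum_univ_two, Real.norm_eq_abs, sq_abs]
  simp
  linear_combination (l.1 ^ 2 + t ^ 2) * Real.sin_sq_add_cos_sq l.2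

namespace Network

variable {Ω : Type*} (N : Network Ω)

/-- The σ-algebra generated by a set of sources. -/
abbrev sigmaOf (S : Set Source) : MeasurableSpace Ω := ⨆ s ∈ S, N.sigma s

variable {N} {S : Set Source}

lemma sigma_le_sigmaOf {s : Source} (h : s ∈ S) : N.sigma s ≤ N.sigmaOf S :=
  le_iSup₂_of_le s h le_rfl

lemma measurable_pi_sigmaOf {ι : Type*} {β : ι → Type*} [∀ i, MeasurableSpace (β i)]
    {f : ∀ i, Ω → β i} (h : ∀ i, Measurable[N.sigmaOf S] (f i)) :
    Measurable[N.sigmaOf S] fun ω i => f i ω :=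
  @measurable_pi_lambda _ _ _ (N.sigmaOf S) _ _ h

lemma measurable_user_sigmaOf (h : Source.users ∈ S) (k : ℕ) :
    Measurable[N.sigmaOf S] (N.user k) :=
  measurable_iff_comap_le.mpr ((le_iSup (fun k => MeasurableSpace.comap (N.user k) inferInstance)
    k).trans (sigma_le_sigmaOf h))

lemma measurable_planar_sigmaOf (h : Source.planar ∈ S) (i : ℕ) :
    Measurable[N.sigmaOf S] (N.planar i) :=
  measurable_iff_comap_le.mpr ((le_iSup (fun k => MeasurableSpace.comap (N.planar k) inferInstance)
    i).trans (sigma_le_sigmaOf h))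

lemma measurable_line_sigmaOf (h : Source.lines ∈ S) (i : ℕ) :
    Measurable[N.sigmaOf S] (N.line i) :=
  measurable_iff_comap_le.mpr ((le_iSup (fun k => MeasurableSpace.comap (N.line k) inferInstance)
    i).trans (sigma_le_sigmaOf h))

lemma measurable_coord_sigmaOf {i : ℕ} (h : Source.onLine i ∈ S) (j : ℕ) :
    Measurable[N.sigmaOf S] (N.coord i j) :=
  measurable_iff_comap_le.mpr ((le_iSup
    (fun k => MeasurableSpace.comap (N.coord i k) inferInstance) j).trans (sigma_le_sigmaOf h))

lemma measurable_fading_sigmaOf {s : Station} (h : Source.fading s ∈ S) :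
    Measurable[N.sigmaOf S] (N.fading s) :=
  measurable_iff_comap_le.mpr (sigma_le_sigmaOf (s := Source.fading s) h)

lemma measurable_pos_inr_sigmaOf (hl : Source.lines ∈ S) (q : ℕ × ℕ)
    (hq : Source.onLine q.1 ∈ S) : Measurable[N.sigmaOf S] (N.pos (Sum.inr q)) :=
  continuous_linePoint.measurable.comp
    ((measurable_line_sigmaOf hl q.1).prodMk (measurable_coord_sigmaOf hq q.2))

lemma measurable_pos_sigmaOf (hp : Source.planar ∈ S) (hl : Source.lines ∈ S)
    (hq : ∀ i, Source.onLine i ∈ S) (s : Station) : Measurable[N.sigmaOf S] (N.pos s) := by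
  rcases s with i | q
  · exact measurable_planar_sigmaOf hp i
  · exact measurable_pos_inr_sigmaOf hl q (hq _)

variable [MeasurableSpace Ω] {P : Measure Ω} {lamB lamU lamL muB : ℝ}

namespace HasModelLaw

variable (hN : N.HasModelLaw P lamB lamU lamL muB)

include hN

lemma sigma_le (s : Source) : N.sigma s ≤ ‹MeasurableSpace Ω› := by
  cases s with
  | users => exact iSup_le fun k => (hN.user.measurable k).comap_le
  | planar => exact iSup_le fun k => (hN.planar.measurable k).comap_le
  | lines => exact iSup_le fun k => (hN.line.measurable k).comap_le
  | onLine i => exact iSup_le fun k => ((hN.coord i).measurable k).comap_le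
  | fading s => exact (hN.fading_measurable s).comap_le

lemma sigmaOf_le (S : Set Source) : N.sigmaOf S ≤ ‹MeasurableSpace Ω› :=
  iSup₂_le fun s _ => hN.sigma_le s

lemma measurable_pos (s : Station) : Measurable (N.pos s) :=
  (measurable_pos_sigmaOf (S := univ) (mem_univ _) (mem_univ _) (fun _ => mem_univ _) s).mono
    (hN.sigmaOf_le _) le_rfl

/-- Grouping independent σ-algebras over disjoint sets of sources preserves independence. This
supplies the pairwise splittings below: positions against fading, planar against vehicular, lines
against coordinates, users against stations. -/
lemma indepFun {β γ : Type*} [MeasurableSpace β] [MeasurableSpace γ] {X : Ω → β} {Y : Ω → γ}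
    (S T : Set Source) (hST : Disjoint S T) (hX : Measurable[N.sigmaOf S] X)
    (hY : Measurable[N.sigmaOf T] Y) : IndepFun X Y P := by
  rw [IndepFun_iff_Indep]
  exact indep_of_indep_of_le_left (indep_of_indep_of_le_right
    (indep_iSup_of_disjoint hN.sigma_le hN.indep hST) hY.comap_le) hX.comap_le

lemma iIndepFun_fading : iIndepFun N.fading P := by
  have : Function.Injective Source.fading := fun a b h => by injection h
  exact (iIndepFun_iff_iIndep _ _ _).mpr (hN.indep.precomp this)

lemma iIndepFun_coord : iIndepFun (fun i ω j => N.coord i j ω) P := by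
  have : Function.Injective Source.onLine := fun a b h => by injection h
  have h := hN.indep.precomp this
  refine (iIndepFun_iff_iIndep _ _ _).mpr ?_
  convert h using 2 with i
  simp only [MeasurableSpace.pi, MeasurableSpace.comap_iSup, MeasurableSpace.comap_comp]
  rfl

lemma measure_fading_le (s : Station) (y : ENNReal) :
    P {ω | y ≤ ENNReal.ofReal (N.fading s ω)} = expNeg y := by
  rw [← expMeasure_one_le_ofReal, ← hN.fading_law s, Measure.map_apply (hN.fading_measurable s)
    (measurableSet_le measurable_const ENNReal.measurable_ofReal)]
  rfl

lemma measure_fading_lt (s : Station) (y : ENNReal) :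
    P {ω | y < ENNReal.ofReal (N.fading s ω)} = expNeg y := by
  rw [← expMeasure_one_lt_ofReal, ← hN.fading_law s, Measure.map_apply (hN.fading_measurable s)
    (measurableSet_lt measurable_const ENNReal.measurable_ofReal)]
  rfl

lemma lintegral_expNeg_mul_fading (s : Station) {c : ℝ} (hc : 0 ≤ c) :
    ∫⁻ ω, expNeg (ENNReal.ofReal c * ENNReal.ofReal (N.fading s ω)) ∂P
      = ENNReal.ofReal (1 + c)⁻¹ := by
  rw [← lintegral_expNeg_mul_expMeasure hc, ← hN.fading_law s, lintegral_map _
    (hN.fading_measurable s)]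
  exact measurable_expNeg.comp (measurable_const.mul ENNReal.measurable_ofReal)

end HasModelLaw

end Network

/-! ### Interference seen by a station at distance `a` -/

/-- `T a^α h ‖x‖^(-α)` for a base station at `x` with fading `h` outside the ball of radius `a`,
and `∞` inside this ball. -/
def mark (T α a : ℝ) (x : Plane) (h : ℝ) : ENNReal :=
  if ‖x‖ < a then ⊤ else
    ENNReal.ofReal (T * a ^ α) * (ENNReal.ofReal h * ‖x‖ₑ ^ (-α))

/-- The exponent of the Laplace transform of `mark` in the fading, at distance `ρ`. -/
def loss (T α a ρ : ℝ) : ENNReal :=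
  if ρ < a then ⊤ else ENNReal.ofReal (Real.log (1 + T * a ^ α * ρ ^ (-α)))

lemma measurable_mark (T α a : ℝ) : Measurable fun q : Plane × ℝ => mark T α a q.1 q.2 := by
  unfold mark
  refine Measurable.ite (measurableSet_lt measurable_fst.norm measurable_const) measurable_const ?_
  exact measurable_const.mul ((ENNReal.measurable_ofReal.comp measurable_snd).mul
    (measurable_fst.enorm.pow_const _))

lemma measurable_mark_comp {Ω : Type*} [MeasurableSpace Ω] (T α a : ℝ) {X : Ω → Plane}
    {H : Ω → ℝ} (hX : Measurable X) (hH : Measurable H) :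
    Measurable fun ω => mark T α a (X ω) (H ω) :=
  Measurable.comp (g := fun q : Plane × ℝ => mark T α a q.1 q.2) (f := fun ω => (X ω, H ω))
    (measurable_mark T α a) (hX.prodMk hH)

lemma measurable_loss (T α a : ℝ) : Measurable (loss T α a) := by
  unfold loss
  refine Measurable.ite (measurableSet_lt measurable_id measurable_const) measurable_const ?_
  fun_prop

lemma loss_mono {T α : ℝ} (hT : 0 < T) (hα : 2 < α) {a b : ℝ} (ha : 0 ≤ a) (hab : a ≤ b)
    {ρ : ℝ} (hρ : 0 ≤ ρ) : loss T α a ρ ≤ loss T α b ρ := by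
  unfold loss
  by_cases hb : ρ < b
  · simp [hb]
  · have ha' : ¬ ρ < a := fun h => hb (h.trans_le hab)
    rw [if_neg ha', if_neg hb]
    have : 0 ≤ T * a ^ α * ρ ^ (-α) := by positivity
    gcongr

/-- The logarithm in `loss` is chosen so that e^{-loss} is the Laplace transform of an exponential
variable of mean one at T a^α ρ^(-α). -/
lemma expNeg_loss {T α : ℝ} (hT : 0 < T) {a ρ : ℝ} (ha : 0 ≤ a) (hρ : a ≤ ρ) :
    expNeg (loss T α a ρ) = ENNReal.ofReal (1 + T * a ^ α * ρ ^ (-α))⁻¹ := by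
  have h0 : 0 ≤ T * a ^ α * ρ ^ (-α) := by
    have := ha.trans hρ
    positivity
  rw [loss, if_neg (not_lt.mpr hρ), expNeg_ofReal (Real.log_nonneg (by linarith)), Real.exp_neg,
    Real.exp_log (by linarith)]

namespace Network

/-- The total mark of all base stations except `s₀`. -/
abbrev shot {Ω : Type*} (N : Network Ω) (T α a : ℝ) (s₀ : Station) (ω : Ω) :
    ENNReal :=
  ∑' s : {s : Station // s ≠ s₀}, mark T α a (N.pos s ω) (N.fading s ω)

variable {Ω : Type*} [MeasurableSpace Ω] {N : Network Ω} {P : Measure Ω}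
  {lamB lamU lamL muB : ℝ}

namespace HasModelLaw

lemma lintegral_expNeg_mark (hN : N.HasModelLaw P lamB lamU lamL muB) {T α a : ℝ} (hT : 0 < T)
    (hα : 2 < α) (ha : 0 ≤ a) (s : Station) (x : Plane) :
    ∫⁻ ω, expNeg (mark T α a x (N.fading s ω)) ∂P = expNeg (loss T α a ‖x‖) := by
  by_cases hx : ‖x‖ < a
  · simp [mark, loss, hx]
  · have hc : 0 ≤ T * a ^ α * ‖x‖ ^ (-α) := by positivity
    rw [expNeg_loss hT ha (not_lt.mp hx), ← hN.lintegral_expNeg_mul_fading s hc]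
    refine lintegral_congr fun ω => ?_
    rw [mark, if_neg hx]
    congr 1
    -- At a = 0 the factor T a^α vanishes, and 0 · ∞ = 0 also covers a station at the origin.
    rcases eq_or_lt_of_le ha with h0 | h0
    · simp [← h0, Real.zero_rpow (by linarith : α ≠ 0)]
    · have hx0 : 0 < ‖x‖ := h0.trans_le (not_lt.mp hx)
      rw [← ofReal_norm, ENNReal.ofReal_rpow_of_pos hx0,
        ENNReal.ofReal_mul (p := T * a ^ α) (by positivity)]
      ring

lemma measurable_shot (hN : N.HasModelLaw P lamB lamU lamL muB) (T α a : ℝ) (s₀ : Station) :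
    Measurable (N.shot T α a s₀) := by
  exact Measurable.tsum fun s =>
    measurable_mark_comp T α a (hN.measurable_pos s) (hN.fading_measurable s)

variable [IsProbabilityMeasure P]

/-- Given all positions, the marks of the other stations are independent functions of their own
fading, so the Laplace transform of their sum is computed station by station. -/
lemma lintegral_expNeg_shot (hN : N.HasModelLaw P lamB lamU lamL muB) {T α a : ℝ} (hT : 0 < T)
    (hα : 2 < α) (ha : 0 ≤ a) (s₀ : Station) {G : Plane → ENNReal} (hG : Measurable G) :
    ∫⁻ ω, G (N.pos s₀ ω) * expNeg (N.shot T α a s₀ ω) ∂P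
      = ∫⁻ ω, G (N.pos s₀ ω) *
          expNeg (∑' s : {s : Station // s ≠ s₀}, loss T α a ‖N.pos s ω‖) ∂P := by
  let S : Set Source := {s | ∀ t, s ≠ Source.fading t}
  have hind : IndepFun (fun ω s => N.pos s ω) (fun ω s => N.fading s ω) P := by
    refine hN.indepFun S Sᶜ disjoint_compl_right ?_ ?_
    · exact measurable_pi_sigmaOf fun s => measurable_pos_sigmaOf (by simp [S]) (by simp [S])
        (by simp [S]) s
    · exact measurable_pi_sigmaOf fun s => measurable_fading_sigmaOf (fun h => h s rfl)
  have hF : Measurable fun q : (Station → Plane) × (Station → ℝ) =>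
      G (q.1 s₀) * expNeg (∑' s : {s : Station // s ≠ s₀}, mark T α a (q.1 s) (q.2 s)) := by
    refine (hG.comp (by fun_prop)).mul (measurable_expNeg.comp (Measurable.tsum fun s => ?_))
    exact measurable_mark_comp T α a (by fun_prop) (by fun_prop)
  rw [lintegral_of_indepFun (measurable_pi_iff.mpr hN.measurable_pos)
    (measurable_pi_iff.mpr hN.fading_measurable) hind (F := fun x h => G (x s₀) *
      expNeg (∑' s : {s : Station // s ≠ s₀}, mark T α a (x s) (h s))) hF]
  refine lintegral_congr fun ω => ?_
  have hmk : ∀ x, Measurable (mark T α a x) := fun x =>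
    measurable_mark_comp T α a measurable_const measurable_id
  have hYm : ∀ s : {s : Station // s ≠ s₀},
      Measurable fun ω' => mark T α a (N.pos s ω) (N.fading s ω') := fun s =>
    measurable_mark_comp T α a measurable_const (hN.fading_measurable s)
  have hE : Measurable fun ω' => expNeg (∑' s : {s : Station // s ≠ s₀},
      mark T α a (N.pos s ω) (N.fading s ω')) := measurable_expNeg.comp (Measurable.tsum hYm)
  refine (lintegral_const_mul _ hE).trans ?_
  congr 1
  refine lintegral_expNeg_tsum_of_iIndepFun hYm ?_ _ fun s =>
    hN.lintegral_expNeg_mark hT hα ha s _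
  have hp : iIndepFun (fun s : {s : Station // s ≠ s₀} => N.fading s) P :=
    hN.iIndepFun_fading.precomp Subtype.val_injective
  exact hp.comp (fun s => mark T α a (N.pos s ω)) fun s => hmk _

/-- The fading of the serving station is independent of all positions and all other fading, so it
can be integrated first with the shot held fixed. The relation `r` stands for `≤` or `<`; both give
e^{-y}, as the exponential law has no atoms. -/
lemma lintegral_serving_indicator (hN : N.HasModelLaw P lamB lamU lamL muB) {T α a : ℝ}
    (s₀ : Station) {G : Plane → ENNReal} (hG : Measurable G)
    {r : ENNReal → ENNReal → Prop} (hr : MeasurableSet {q : ENNReal × ENNReal | r q.1 q.2})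
    (hrP : ∀ y, P {ω | r y (ENNReal.ofReal (N.fading s₀ ω))} = expNeg y) :
    ∫⁻ ω, G (N.pos s₀ ω) * {ω | r (N.shot T α a s₀ ω)
        (ENNReal.ofReal (N.fading s₀ ω))}.indicator 1 ω ∂P
      = ∫⁻ ω, G (N.pos s₀ ω) * expNeg (N.shot T α a s₀ ω) ∂P := by
  let S : Set Source := {Source.fading s₀}
  have hind : IndepFun (fun ω => ((fun s => N.pos s ω : Station → Plane),
      (fun s : {s : Station // s ≠ s₀} => N.fading s ω))) (N.fading s₀) P := by
    refine hN.indepFun Sᶜ S disjoint_compl_left (Measurable.prodMk ?_ ?_) ?_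
    · exact measurable_pi_sigmaOf fun s => measurable_pos_sigmaOf (by simp [S]) (by simp [S])
        (by simp [S]) s
    · exact measurable_pi_sigmaOf fun s => measurable_fading_sigmaOf (by simpa [S] using s.2)
    · exact measurable_fading_sigmaOf rfl
  let Z : (Station → Plane) × ({s : Station // s ≠ s₀} → ℝ) → ENNReal := fun v =>
    ∑' s : {s : Station // s ≠ s₀}, mark T α a (v.1 s) (v.2 s)
  have hZ : Measurable Z := by
    refine Measurable.tsum fun s =>
      measurable_mark_comp T α a (by fun_prop) (by fun_prop)
  have hV : Measurable fun ω => ((fun s => N.pos s ω : Station → Plane),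
      (fun s : {s : Station // s ≠ s₀} => N.fading s ω)) :=
    (measurable_pi_iff.mpr hN.measurable_pos).prodMk
      (measurable_pi_iff.mpr fun s => hN.fading_measurable s)
  have hF : Measurable fun q : ((Station → Plane) × ({s : Station // s ≠ s₀} → ℝ)) × ℝ =>
      G (q.1.1 s₀) * {p : ENNReal × ENNReal | r p.1 p.2}.indicator (1 : ENNReal × ENNReal → ENNReal)
        (Z q.1, ENNReal.ofReal q.2) := by
    refine (hG.comp (by fun_prop)).mul ((measurable_one.indicator hr).comp ?_)
    exact (hZ.comp measurable_fst).prodMk (ENNReal.measurable_ofReal.comp measurable_snd)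
  have key := lintegral_of_indepFun hV (hN.fading_measurable s₀) hind
    (F := fun v h => G (v.1 s₀) * {p : ENNReal × ENNReal | r p.1 p.2}.indicator
      (1 : ENNReal × ENNReal → ENNReal) (Z v, ENNReal.ofReal h)) hF
  refine key.trans (lintegral_congr fun ω => ?_)
  have hm : MeasurableSet {ω' | r (N.shot T α a s₀ ω) (ENNReal.ofReal (N.fading s₀ ω'))} :=
    (measurable_const.prodMk (ENNReal.measurable_ofReal.comp (hN.fading_measurable s₀))) hr
  have hm1 : Measurable ({ω' | r (N.shot T α a s₀ ω)
      (ENNReal.ofReal (N.fading s₀ ω'))}.indicator (1 : Ω → ENNReal)) :=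
    measurable_one.indicator hm
  refine (lintegral_const_mul _ hm1).trans ?_
  rw [lintegral_indicator_one hm, hrP]

lemma measure_serving_le (hN : N.HasModelLaw P lamB lamU lamL muB) {T α a : ℝ} (hT : 0 < T)
    (hα : 2 < α) (ha : 0 ≤ a) (s₀ : Station) {D : Set Plane} (hD : MeasurableSet D) :
    P {ω | N.pos s₀ ω ∈ D ∧ N.shot T α a s₀ ω ≤ ENNReal.ofReal (N.fading s₀ ω)}
      = ∫⁻ ω, D.indicator 1 (N.pos s₀ ω) *
          expNeg (∑' s : {s : Station // s ≠ s₀}, loss T α a ‖N.pos s ω‖) ∂P := by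
  rw [← hN.lintegral_expNeg_shot hT hα ha s₀ (measurable_one.indicator hD),
    ← hN.lintegral_serving_indicator (r := (· ≤ ·)) s₀ (measurable_one.indicator hD)
      (measurableSet_le measurable_fst measurable_snd) (hN.measure_fading_le s₀)]
  have hm : MeasurableSet {ω | N.shot T α a s₀ ω ≤ ENNReal.ofReal (N.fading s₀ ω)} :=
    measurableSet_le (hN.measurable_shot T α a s₀)
      (ENNReal.measurable_ofReal.comp (hN.fading_measurable s₀))
  have hm' := (hN.measurable_pos s₀ hD).inter hm
  refine (lintegral_indicator_one hm').symm.trans (lintegral_congr fun ω => ?_)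
  rw [Set.inter_indicator_one]
  rfl

lemma measure_serving_lt (hN : N.HasModelLaw P lamB lamU lamL muB) {T α a : ℝ} (hT : 0 < T)
    (hα : 2 < α) (ha : 0 ≤ a) (s₀ : Station) {D : Set Plane} (hD : MeasurableSet D) :
    P {ω | N.pos s₀ ω ∈ D ∧ N.shot T α a s₀ ω < ENNReal.ofReal (N.fading s₀ ω)}
      = ∫⁻ ω, D.indicator 1 (N.pos s₀ ω) *
          expNeg (∑' s : {s : Station // s ≠ s₀}, loss T α a ‖N.pos s ω‖) ∂P := by
  rw [← hN.lintegral_expNeg_shot hT hα ha s₀ (measurable_one.indicator hD),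
    ← hN.lintegral_serving_indicator (r := (· < ·)) s₀ (measurable_one.indicator hD)
      (measurableSet_lt measurable_fst measurable_snd) (hN.measure_fading_lt s₀)]
  have hm : MeasurableSet {ω | N.shot T α a s₀ ω < ENNReal.ofReal (N.fading s₀ ω)} :=
    measurableSet_lt (hN.measurable_shot T α a s₀)
      (ENNReal.measurable_ofReal.comp (hN.fading_measurable s₀))
  have hm' := (hN.measurable_pos s₀ hD).inter hm
  refine (lintegral_indicator_one hm').symm.trans (lintegral_congr fun ω => ?_)
  rw [Set.inter_indicator_one]
  rfl

end HasModelLaw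

end Network

/-! ### Laplace functional of the network -/

lemma sigmaFinite_ofReal_smul {E : Type*} [MeasurableSpace E] (c : ℝ) (μ : Measure E)
    [SigmaFinite μ] : SigmaFinite (ENNReal.ofReal c • μ) :=
  inferInstanceAs (SigmaFinite (c.toNNReal • μ))

/-- `∫ (1 - e^{-loss})` over the plane. -/
def planarLoss (T α a : ℝ) : ENNReal :=
  ∫⁻ x : Plane, (1 - expNeg (loss T α a ‖x‖))

lemma measurable_loss_norm (T α a : ℝ) : Measurable fun x : Plane => loss T α a ‖x‖ :=
  (measurable_loss T α a).comp measurable_norm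

lemma tsum_ne_eq_tsum {ι : Type*} {w : ι → ENNReal} {s₀ : ι} (h : w s₀ = 0) :
    ∑' s : {s : ι // s ≠ s₀}, w s = ∑' s, w s := by
  classical
  refine (tsum_subtype {s | s ≠ s₀} w).trans (tsum_congr fun s => ?_)
  by_cases hs : s = s₀
  · simp [hs, h]
  · simp [hs]

namespace Network

variable {Ω : Type*}

/-- The loss of the base stations that are vehicular or lie outside `D`. -/
def lossOutside (N : Network Ω) (T α a : ℝ) (D : Set Plane) (ω : Ω) : Station → ENNReal :=
  Sum.elim (fun i => Dᶜ.indicator (fun x => loss T α a ‖x‖) (N.planar i ω))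
    (fun q => loss T α a ‖N.pos (Sum.inr q) ω‖)

lemma lossOutside_le (N : Network Ω) (T α a : ℝ) (D : Set Plane) (ω : Ω) (s : Station) :
    N.lossOutside T α a D ω s ≤ loss T α a ‖N.pos s ω‖ := by
  rcases s with i | q
  · exact indicator_le_self Dᶜ (fun x => loss T α a ‖x‖) _
  · exact le_rfl

/-- Forgetting the losses of the planar stations in `D` only increases the exponential, and makes
the term the same for every serving station in `D`. -/
lemma sum_indicator_mul_expNeg_le (N : Network Ω) (T α a : ℝ) {D : Set Plane}
    (hD : MeasurableSet D) (ω : Ω) :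
    ∑' i : ℕ, D.indicator 1 (N.pos (Sum.inl i) ω) *
        expNeg (∑' s : {s : Station // s ≠ Sum.inl i}, loss T α a ‖N.pos s ω‖)
      ≤ counting N.planar ω D * expNeg (∑' s, N.lossOutside T α a D ω s) := by
  rw [counting_apply _ _ hD, ← ENNReal.tsum_mul_right]
  refine ENNReal.tsum_le_tsum fun i => ?_
  by_cases hi : N.planar i ω ∈ D
  · refine mul_le_mul' le_rfl (expNeg_antitone ?_)
    rw [← tsum_ne_eq_tsum (s₀ := Sum.inl i) (by simp [lossOutside, hi])]
    exact ENNReal.tsum_le_tsum fun s => N.lossOutside_le T α a D ω s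
  · have : N.pos (Sum.inl i) ω ∉ D := hi
    simp [this]

/-- When `D` holds exactly one planar station, removing the serving station removes all of `D`, so
its term is exactly the left-hand side. Other configurations are discarded. -/
lemma le_sum_indicator_mul_expNeg (N : Network Ω) (T α a : ℝ) {D : Set Plane}
    (hD : MeasurableSet D) (ω : Ω) :
    ({1} : Set ENNReal).indicator 1 (counting N.planar ω D)
        * expNeg (∑' s, N.lossOutside T α a D ω s)
      ≤ ∑' i : ℕ, D.indicator 1 (N.pos (Sum.inl i) ω) *
        expNeg (∑' s : {s : Station // s ≠ Sum.inl i}, loss T α a ‖N.pos s ω‖) := by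
  by_cases h1 : counting N.planar ω D = 1
  swap
  · simp [h1]
  have h2 := counting_apply N.planar ω hD
  rw [h1] at h2
  obtain ⟨i, hi⟩ : ∃ i, N.planar i ω ∈ D := by
    by_contra! hcon
    simp [hcon] at h2
  have hj : ∀ j, j ≠ i → N.planar j ω ∉ D := by
    intro j hji hj
    have h3 := ENNReal.sum_le_tsum (f := fun i => D.indicator (1 : Plane → ENNReal) (N.planar i ω))
      {j, i}
    -- A second label in `D` would make the count at least 2.
    rw [Finset.sum_pair hji, ← h2] at h3
    simp only [indicator_of_mem hj, indicator_of_mem hi, Pi.one_apply] at h3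
    norm_num at h3
  refine le_trans ?_ (ENNReal.le_tsum i)
  have hi' : N.pos (Sum.inl i) ω ∈ D := hi
  rw [indicator_of_mem (by simpa using h1), indicator_of_mem hi', Pi.one_apply, Pi.one_apply,
    one_mul, one_mul, ← tsum_ne_eq_tsum (s₀ := Sum.inl i) (by simp [lossOutside, hi])]
  refine expNeg_antitone (ENNReal.tsum_le_tsum ?_)
  rintro ⟨j | q, hs⟩
  · have hji : j ≠ i := fun h => hs (by rw [h])
    have : N.lossOutside T α a D ω (Sum.inl j) = loss T α a ‖N.planar j ω‖ := by
      simp [lossOutside, hj j hji]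
    exact this.ge
  · exact le_rfl

variable [MeasurableSpace Ω]

/-- The mean of `e^{-loss}` summed over the vehicular base stations. -/
def vehicularLaplace (N : Network Ω) (P : Measure Ω) (T α a : ℝ) : ENNReal :=
  ∫⁻ ω, expNeg (∑' q : ℕ × ℕ, loss T α a ‖N.pos (Sum.inr q) ω‖) ∂P

/-- The mean of `e^{-loss}` summed over all base stations. -/
def laplace (N : Network Ω) (P : Measure Ω) (lamB T α a : ℝ) : ENNReal :=
  expNeg (ENNReal.ofReal lamB * planarLoss T α a) * N.vehicularLaplace P T α a

lemma laplace_le_one (N : Network Ω) (P : Measure Ω) [IsProbabilityMeasure P] (lamB T α a : ℝ) :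
    N.laplace P lamB T α a ≤ 1 := by
  refine mul_le_one' (expNeg_le_one _) ?_
  calc N.vehicularLaplace P T α a ≤ ∫⁻ _, 1 ∂P := lintegral_mono fun ω => expNeg_le_one _
    _ = 1 := by simp

/-- A larger radius enlarges the ball of infinite loss and raises the loss outside it. This
monotonicity gives the Riemann sum comparison and, later, measurability in the radius. -/
lemma laplace_antitone (N : Network Ω) (P : Measure Ω) (lamB : ℝ) {T α a b : ℝ}
    (hT : 0 < T) (hα : 2 < α) (ha : 0 ≤ a) (hab : a ≤ b) :
    N.laplace P lamB T α b ≤ N.laplace P lamB T α a := by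
  have h := fun x : Plane => loss_mono hT hα ha hab (norm_nonneg x)
  refine mul_le_mul' (expNeg_antitone (mul_le_mul' le_rfl (lintegral_mono fun x => ?_)))
    (lintegral_mono fun ω => ?_)
  · exact tsub_le_tsub_left (expNeg_antitone (h x)) 1
  · exact expNeg_antitone (ENNReal.tsum_le_tsum fun q => h _)

namespace HasModelLaw

variable {N : Network Ω} {P : Measure Ω} [IsProbabilityMeasure P] {lamB lamU lamL muB : ℝ}

/-- The vehicular factor splits off because it comes from other sources; the planar loss splits from
the count because it involves only points outside `D`. -/
lemma lintegral_count_mul_lossOutside (hN : N.HasModelLaw P lamB lamU lamL muB) (T α a : ℝ)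
    {D : Set Plane} (hD : MeasurableSet D) (hfin : (ENNReal.ofReal lamB • volume) D ≠ ⊤)
    {g : ENNReal → ENNReal} (hg : Measurable g)
    (hgfin : ∫⁻ ω, g (counting N.planar ω D) ∂P ≠ ⊤) :
    ∫⁻ ω, g (counting N.planar ω D) * expNeg (∑' s, N.lossOutside T α a D ω s) ∂P
      = (∫⁻ ω, g (counting N.planar ω D) ∂P) *
        expNeg (ENNReal.ofReal lamB * ∫⁻ x in Dᶜ, (1 - expNeg (loss T α a ‖x‖))) *
        N.vehicularLaplace P T α a := by
  have := sigmaFinite_ofReal_smul lamB (volume : Measure Plane)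
  let f : Plane → ENNReal := Dᶜ.indicator fun x => loss T α a ‖x‖
  have hf : Measurable f := (measurable_loss_norm T α a).indicator hD.compl
  have hpl := hN.planar.lintegral_count_mul_expNeg hD hfin g hg hgfin hf
    (fun x hx => indicator_of_notMem (by simpa using hx) _)
  let φ : (ℕ → Plane) → ENNReal := fun x =>
    g (∑' i, D.indicator 1 (x i)) * expNeg (∑' i, f (x i))
  let ψ : (ℕ × ℕ → Plane) → ENNReal := fun y => expNeg (∑' q, loss T α a ‖y q‖)
  have hφ : Measurable φ := by
    refine (hg.comp (Measurable.tsum fun i => ?_)).mul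
      (measurable_expNeg.comp (Measurable.tsum fun i => hf.comp (measurable_pi_apply i)))
    exact Measurable.comp (g := D.indicator (1 : Plane → ENNReal)) (measurable_one.indicator hD)
      (measurable_pi_apply i)
  have hψ : Measurable ψ := by
    refine measurable_expNeg.comp (Measurable.tsum fun q => ?_)
    exact Measurable.comp (g := fun x : Plane => loss T α a ‖x‖) (measurable_loss_norm T α a)
      (measurable_pi_apply q)
  have hX : Measurable fun ω i => N.planar i ω := measurable_pi_iff.mpr hN.planar.measurable
  have hY : Measurable fun ω q => N.pos (Sum.inr q) ω :=
    measurable_pi_iff.mpr fun q => hN.measurable_pos _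
  have hind : IndepFun (fun ω i => N.planar i ω) (fun ω q => N.pos (Sum.inr q) ω) P := by
    refine hN.indepFun {Source.planar} {Source.planar}ᶜ disjoint_compl_right ?_ ?_
    · exact measurable_pi_sigmaOf fun i => measurable_planar_sigmaOf (mem_singleton _) i
    · exact measurable_pi_sigmaOf fun q => measurable_pos_inr_sigmaOf (by simp) q (by simp)
  have hprod := lintegral_mul_eq_lintegral_mul_lintegral_of_indepFun (hφ.comp hX) (hψ.comp hY)
    (hind.comp hφ hψ)
  have e1 : ∀ ω, g (counting N.planar ω D) * expNeg (∑' s, N.lossOutside T α a D ω s)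
      = ((φ ∘ fun ω i => N.planar i ω) * (ψ ∘ fun ω q => N.pos (Sum.inr q) ω)) ω := by
    intro ω
    rw [Summable.tsum_sum ENNReal.summable ENNReal.summable, expNeg_add, ← mul_assoc,
      counting_apply _ _ hD]
    rfl
  rw [lintegral_congr e1, hprod]
  congr 1
  calc _ = ∫⁻ ω, g (counting N.planar ω D) * expNeg (∑' i, f (N.planar i ω)) ∂P := by
        refine lintegral_congr fun ω => ?_
        rw [counting_apply _ _ hD]
        rfl
    _ = _ := by
        rw [hpl, lintegral_smul_measure, smul_eq_mul, ← lintegral_indicator hD.compl]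
        congr 4
        ext x
        by_cases hx : x ∈ D <;> simp [f, hx]

lemma sum_measure_serving_le (hN : N.HasModelLaw P lamB lamU lamL muB) {T α a : ℝ} (hT : 0 < T)
    (hα : 2 < α) (ha : 0 ≤ a) {D : Set Plane} (hD : MeasurableSet D)
    (hfin : ENNReal.ofReal lamB * volume D ≠ ⊤) :
    expNeg (ENNReal.ofReal lamB * volume D) *
      ∑' i : ℕ, P {ω | N.pos (Sum.inl i) ω ∈ D ∧
        N.shot T α a (Sum.inl i) ω ≤ ENNReal.ofReal (N.fading (Sum.inl i) ω)}
      ≤ ENNReal.ofReal lamB * volume D * N.laplace P lamB T α a := by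
  have hfin' : (ENNReal.ofReal lamB • volume) D ≠ ⊤ := by simpa using hfin
  have hc := hN.planar.lintegral_counting_eq hD hfin'
  -- The integrand is at most 1, so extending the exponent from the complement of `D` to the plane
  -- adds at most the area of `D`. This is the origin of the factor `expNeg (ENNReal.ofReal lamB *
  -- volume D)` in the statement.
  have hpl : planarLoss T α a
      ≤ volume D + ∫⁻ x in Dᶜ, (1 - expNeg (loss T α a ‖x‖)) := by
    rw [planarLoss, ← lintegral_add_compl _ hD]
    refine add_le_add_left ?_ _
    calc ∫⁻ x in D, (1 - expNeg (loss T α a ‖x‖)) ≤ ∫⁻ _ in D, 1 :=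
          lintegral_mono fun x => tsub_le_self
      _ = volume D := by simp
  calc _ = expNeg (ENNReal.ofReal lamB * volume D) * ∫⁻ ω, ∑' i : ℕ,
          D.indicator 1 (N.pos (Sum.inl i) ω) *
          expNeg (∑' s : {s : Station // s ≠ Sum.inl i}, loss T α a ‖N.pos s ω‖) ∂P := by
        rw [lintegral_tsum]
        · simp_rw [hN.measure_serving_le hT hα ha _ hD]
        · intro i
          refine (((measurable_one.indicator hD).comp (hN.measurable_pos _)).mul
            (measurable_expNeg.comp (Measurable.tsum fun s => ?_))).aemeasurable
          exact (measurable_loss_norm T α a).comp (hN.measurable_pos _)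
    _ ≤ expNeg (ENNReal.ofReal lamB * volume D) * ∫⁻ ω, counting N.planar ω D *
          expNeg (∑' s, N.lossOutside T α a D ω s) ∂P := by
        gcongr with ω
        exact N.sum_indicator_mul_expNeg_le T α a hD ω
    _ = ENNReal.ofReal lamB * volume D * (expNeg (ENNReal.ofReal lamB *
          (volume D + ∫⁻ x in Dᶜ, (1 - expNeg (loss T α a ‖x‖)))) *
          N.vehicularLaplace P T α a) := by
        rw [hN.lintegral_count_mul_lossOutside T α a hD hfin' (g := fun x => x) measurable_id
          (by rw [hc]; exact hfin'), hc, mul_add, expNeg_add, Measure.smul_apply, smul_eq_mul]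
        ring
    _ ≤ _ := by
        unfold laplace
        gcongr
        exact expNeg_antitone (mul_le_mul' le_rfl hpl)

lemma le_sum_measure_serving (hN : N.HasModelLaw P lamB lamU lamL muB) {T α a : ℝ} (hT : 0 < T)
    (hα : 2 < α) (ha : 0 ≤ a) {D : Set Plane} (hD : MeasurableSet D)
    (hfin : ENNReal.ofReal lamB * volume D ≠ ⊤) :
    expNeg (ENNReal.ofReal lamB * volume D) *
      (ENNReal.ofReal lamB * volume D * N.laplace P lamB T α a)
      ≤ ∑' i : ℕ, P {ω | N.pos (Sum.inl i) ω ∈ D ∧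
        N.shot T α a (Sum.inl i) ω < ENNReal.ofReal (N.fading (Sum.inl i) ω)} := by
  have hfin' : (ENNReal.ofReal lamB • volume) D ≠ ⊤ := by simpa using hfin
  have hm : Measurable fun ω => counting N.planar ω D :=
    measurable_counting hN.planar.measurable hD
  have hone : Measurable (({1} : Set ENNReal).indicator (1 : ENNReal → ENNReal)) :=
    measurable_one.indicator (measurableSet_singleton _)
  -- The Poisson probability of exactly one point in `D`. Here the exponential factor comes from
  -- keeping only that event.
  have hc : ∫⁻ ω, ({1} : Set ENNReal).indicator 1 (counting N.planar ω D) ∂P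
      = expNeg (ENNReal.ofReal lamB * volume D) * (ENNReal.ofReal lamB * volume D) := by
    have := hN.planar.measure_count_eq_one hD hfin'
    rw [Measure.smul_apply, smul_eq_mul] at this
    rw [← this]
    exact lintegral_indicator_one (hm (measurableSet_singleton 1))
  calc expNeg (ENNReal.ofReal lamB * volume D) *
      (ENNReal.ofReal lamB * volume D * N.laplace P lamB T α a)
      ≤ expNeg (ENNReal.ofReal lamB * volume D) * (ENNReal.ofReal lamB * volume D) *
        expNeg (ENNReal.ofReal lamB * ∫⁻ x in Dᶜ, (1 - expNeg (loss T α a ‖x‖))) *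
        N.vehicularLaplace P T α a := by
        unfold laplace
        rw [← mul_assoc, ← mul_assoc]
        refine mul_le_mul' (mul_le_mul' le_rfl ?_) le_rfl
        exact expNeg_antitone (mul_le_mul' le_rfl (setLIntegral_le_lintegral _ _))
    _ = ∫⁻ ω, ({1} : Set ENNReal).indicator 1 (counting N.planar ω D) *
          expNeg (∑' s, N.lossOutside T α a D ω s) ∂P := by
        rw [hN.lintegral_count_mul_lossOutside T α a hD hfin' hone ?_, hc]
        rw [hc]
        exact ENNReal.mul_ne_top (expNeg_ne_top _) hfin
    _ ≤ ∫⁻ ω, ∑' i : ℕ, D.indicator 1 (N.pos (Sum.inl i) ω) *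
          expNeg (∑' s : {s : Station // s ≠ Sum.inl i}, loss T α a ‖N.pos s ω‖) ∂P :=
        lintegral_mono fun ω => N.le_sum_indicator_mul_expNeg T α a hD ω
    _ = _ := by
        rw [lintegral_tsum]
        · simp_rw [hN.measure_serving_lt hT hα ha _ hD]
        · intro i
          refine (((measurable_one.indicator hD).comp (hN.measurable_pos _)).mul
            (measurable_expNeg.comp (Measurable.tsum fun s => ?_))).aemeasurable
          exact (measurable_loss_norm T α a).comp (hN.measurable_pos _)

end HasModelLaw

end Network

/-! ### Riemann sums of antitone functions -/

lemma iUnion_Ico_nat_mul {δ : ℝ} (hδ : 0 < δ) :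
    ⋃ k : ℕ, Ico (k * δ) ((k + 1) * δ) = Ici (0 : ℝ) := by
  ext x
  simp only [mem_iUnion, mem_Ico, mem_Ici]
  constructor
  · rintro ⟨k, hk, -⟩
    exact le_trans (by positivity) hk
  · intro hx
    refine ⟨⌊x / δ⌋₊, ?_, ?_⟩
    · exact (le_div_iff₀ hδ).mp (Nat.floor_le (by positivity))
    · exact (div_lt_iff₀ hδ).mp (Nat.lt_floor_add_one _)

lemma pairwise_disjoint_Ico_nat_mul {δ : ℝ} (hδ : 0 < δ) :
    Pairwise (Function.onFun Disjoint fun k : ℕ => Ico (k * δ) ((k + 1) * δ)) := by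
  have key : ∀ i j : ℕ, i < j → Disjoint (Ico (i * δ) ((i + 1) * δ)) (Ico (j * δ) ((j + 1) * δ)) := by
    intro i j hij
    refine Set.disjoint_left.mpr fun x hx hx' => ?_
    have h1 : ((i : ℝ) + 1) * δ ≤ j * δ := by
      gcongr
      exact_mod_cast hij
    linarith [hx.2, hx'.1]
  intro i j hij
  rcases lt_or_gt_of_ne hij with h | h
  · exact key i j h
  · exact (key j i h).symm

lemma lintegral_Ioi_eq_tsum {δ : ℝ} (hδ : 0 < δ) (Q : ℝ → ENNReal) :
    ∫⁻ t in Ioi (0 : ℝ), Q t = ∑' k : ℕ, ∫⁻ t in Ico (k * δ) ((k + 1) * δ), Q t := by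
  rw [setLIntegral_congr (Ioi_ae_eq_Ici (a := (0 : ℝ))), ← iUnion_Ico_nat_mul hδ,
    lintegral_iUnion (fun k => measurableSet_Ico) (pairwise_disjoint_Ico_nat_mul hδ)]

variable {Q : ℝ → ENNReal}

lemma lintegral_Ioi_le_sum {δ : ℝ} (hδ : 0 < δ) (hQ : AntitoneOn Q (Ici 0)) :
    ∫⁻ t in Ioi (0 : ℝ), Q t ≤ ∑' k : ℕ, ENNReal.ofReal δ * Q (k * δ) := by
  rw [lintegral_Ioi_eq_tsum hδ]
  refine ENNReal.tsum_le_tsum fun k => ?_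
  calc ∫⁻ t in Ico (k * δ) ((k + 1) * δ), Q t
      ≤ ∫⁻ _ in Ico (k * δ) ((k + 1) * δ), Q (k * δ) := by
        refine setLIntegral_mono' measurableSet_Ico fun t ht => ?_
        have h0 : (0 : ℝ) ≤ k * δ := by positivity
        exact hQ h0 (h0.trans ht.1) ht.1
    _ = ENNReal.ofReal δ * Q (k * δ) := by
        rw [setLIntegral_const, Real.volume_Ico, mul_comm]
        congr 2
        ring

lemma sum_le_lintegral_Ioi {δ : ℝ} (hδ : 0 < δ) (hQ : AntitoneOn Q (Ici 0)) :
    ∑' k : ℕ, ENNReal.ofReal δ * Q ((k + 1 : ℕ) * δ) ≤ ∫⁻ t in Ioi (0 : ℝ), Q t := by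
  rw [lintegral_Ioi_eq_tsum hδ]
  refine ENNReal.tsum_le_tsum fun k => ?_
  calc ENNReal.ofReal δ * Q ((k + 1 : ℕ) * δ)
      = ∫⁻ _ in Ico (k * δ) ((k + 1) * δ), Q ((k + 1 : ℕ) * δ) := by
        rw [setLIntegral_const, Real.volume_Ico, mul_comm]
        congr 2
        ring
    _ ≤ _ := by
        refine setLIntegral_mono' measurableSet_Ico fun t ht => ?_
        have h0 : (0 : ℝ) ≤ k * δ := by positivity
        refine hQ (h0.trans ht.1) (mem_Ici.mpr (by positivity)) ?_
        push_cast
        exact ht.2.le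

/-- A number squeezed between scaled lower and upper Riemann sums is the integral. -/
lemma eq_mul_lintegral_of_riemann_bounds {A : ENNReal} {m : ℝ}
    (hQ : AntitoneOn Q (Ici 0)) (hQ1 : ∀ t, Q t ≤ 1)
    (hup : ∀ δ : ℝ, 0 < δ → expNeg (ENNReal.ofReal (m * δ)) * A
      ≤ ENNReal.ofReal m * ∑' k : ℕ, ENNReal.ofReal δ * Q (k * δ))
    (hlo : ∀ δ : ℝ, 0 < δ → expNeg (ENNReal.ofReal (m * δ)) *
      (ENNReal.ofReal m * ∑' k : ℕ, ENNReal.ofReal δ * Q ((k + 2 : ℕ) * δ)) ≤ A) :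
    A = ENNReal.ofReal m * ∫⁻ t in Ioi (0 : ℝ), Q t := by
  set I := ∫⁻ t in Ioi (0 : ℝ), Q t
  have hone : ∀ δ t, ENNReal.ofReal δ * Q t ≤ ENNReal.ofReal δ := fun δ t =>
    mul_le_of_le_one_right zero_le (hQ1 t)
  -- The left-endpoint sum is the right-endpoint sum plus its first term, which is at most δ because
  -- Q ≤ 1.
  have hup' : ∀ δ : ℝ, 0 < δ → expNeg (ENNReal.ofReal (m * δ)) * A
      ≤ ENNReal.ofReal m * (I + ENNReal.ofReal δ) := by
    intro δ hδ
    refine (hup δ hδ).trans (mul_le_mul' le_rfl ?_)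
    rw [tsum_eq_zero_add' ENNReal.summable, add_comm]
    exact add_le_add (sum_le_lintegral_Ioi hδ hQ) (hone _ _)
  -- A sum starting at index 2 misses two terms of the left-endpoint sum, each at most δ.
  have hlo' : ∀ δ : ℝ, 0 < δ → expNeg (ENNReal.ofReal (m * δ)) * (ENNReal.ofReal m * I)
      ≤ A + ENNReal.ofReal m * (ENNReal.ofReal δ + ENNReal.ofReal δ) := by
    intro δ hδ
    have h1 : I ≤ ∑' k : ℕ, ENNReal.ofReal δ * Q ((k + 2 : ℕ) * δ)
        + (ENNReal.ofReal δ + ENNReal.ofReal δ) := by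
      refine (lintegral_Ioi_le_sum hδ hQ).trans ?_
      rw [tsum_eq_zero_add' ENNReal.summable, tsum_eq_zero_add' ENNReal.summable, ← add_assoc,
        add_comm]
      exact add_le_add le_rfl (add_le_add (hone _ _) (hone _ _))
    calc _ ≤ expNeg (ENNReal.ofReal (m * δ)) * (ENNReal.ofReal m *
          (∑' k : ℕ, ENNReal.ofReal δ * Q ((k + 2 : ℕ) * δ)
            + (ENNReal.ofReal δ + ENNReal.ofReal δ))) := by gcongr
      _ ≤ _ := by
        rw [mul_add, mul_add]
        exact add_le_add (hlo δ hδ) (mul_le_of_le_one_left zero_le (expNeg_le_one _))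
  have hδ0 : Tendsto (fun δ : ℝ => ENNReal.ofReal δ) (𝓝[>] 0) (𝓝 0) := by
    have := (ENNReal.continuous_ofReal.tendsto 0).mono_left (nhdsWithin_le_nhds (s := Ioi 0))
    simpa using this
  have hexp : ∀ B : ENNReal, Tendsto (fun δ : ℝ => expNeg (ENNReal.ofReal (m * δ)) * B) (𝓝[>] 0)
      (𝓝 B) := by
    intro B
    have h1 : Tendsto (fun δ : ℝ => expNeg (ENNReal.ofReal (m * δ))) (𝓝[>] 0) (𝓝 1) := by
      have hc : Continuous fun δ : ℝ => expNeg (ENNReal.ofReal (m * δ)) :=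
        continuous_expNeg.comp (ENNReal.continuous_ofReal.comp (continuous_const.mul continuous_id))
      have := (hc.tendsto 0).mono_left (nhdsWithin_le_nhds (s := Ioi 0))
      simpa using this
    simpa using ENNReal.Tendsto.mul_const h1 (Or.inl one_ne_zero)
  apply le_antisymm
  · have hr : Tendsto (fun δ : ℝ => ENNReal.ofReal m * (I + ENNReal.ofReal δ)) (𝓝[>] 0)
        (𝓝 (ENNReal.ofReal m * (I + 0))) :=
      ENNReal.Tendsto.const_mul (tendsto_const_nhds.add hδ0) (Or.inr ENNReal.ofReal_ne_top)
    rw [add_zero] at hr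
    exact le_of_tendsto_of_tendsto (hexp A) hr (eventually_mem_nhdsWithin.mono hup')
  · have hr : Tendsto (fun δ : ℝ => A + ENNReal.ofReal m *
        (ENNReal.ofReal δ + ENNReal.ofReal δ)) (𝓝[>] 0)
        (𝓝 (A + ENNReal.ofReal m * (0 + 0))) :=
      tendsto_const_nhds.add
        (ENNReal.Tendsto.const_mul (hδ0.add hδ0) (Or.inr ENNReal.ofReal_ne_top))
    rw [add_zero, mul_zero, add_zero] at hr
    exact le_of_tendsto_of_tendsto (hexp _) hr (eventually_mem_nhdsWithin.mono hlo')

/-! ### Annuli -/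

/-- The annulus of area `π δ` with inner radius `√(k δ)`. -/
def annulus (δ : ℝ) (k : ℕ) : Set Plane :=
  {x | Real.sqrt (k * δ) ≤ ‖x‖ ∧ ‖x‖ < Real.sqrt ((k + 1 : ℕ) * δ)}

lemma measurableSet_annulus (δ : ℝ) (k : ℕ) : MeasurableSet (annulus δ k) :=
  (measurableSet_le measurable_const measurable_norm).inter
    (measurableSet_lt measurable_norm measurable_const)

lemma volume_annulus {δ : ℝ} (hδ : 0 < δ) (k : ℕ) :
    volume (annulus δ k) = ENNReal.ofReal (Real.pi * δ) := by
  have hb : ∀ n : ℕ, volume (Metric.ball (0 : Plane) (Real.sqrt (n * δ)))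
      = ENNReal.ofReal (n * δ * Real.pi) := by
    intro n
    rw [EuclideanSpace.volume_ball_fin_two, ← ENNReal.ofReal_pow (Real.sqrt_nonneg _),
      Real.sq_sqrt (by positivity), ← ENNReal.ofReal_mul (by positivity)]
  have he : annulus δ k = Metric.ball (0 : Plane) (Real.sqrt ((k + 1 : ℕ) * δ)) \
      Metric.ball (0 : Plane) (Real.sqrt (k * δ)) := by
    ext x
    simp only [annulus, mem_ofPred_eq, Set.mem_sdiff, mem_ball_zero_iff, not_lt]
    exact and_comm
  rw [he, measure_sdiff _ measurableSet_ball.nullMeasurableSet, hb, hb, ← ENNReal.ofReal_sub _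
    (by positivity)]
  · congr 1
    push_cast
    ring
  · rw [hb]
    exact ENNReal.ofReal_ne_top
  · refine Metric.ball_subset_ball (Real.sqrt_le_sqrt ?_)
    gcongr
    omega

lemma exists_mem_annulus {δ : ℝ} (hδ : 0 < δ) (x : Plane) : ∃ k, x ∈ annulus δ k := by
  have h : ‖x‖ ^ 2 ∈ ⋃ k : ℕ, Ico (k * δ) ((k + 1) * δ) := by
    rw [iUnion_Ico_nat_mul hδ]
    exact sq_nonneg ‖x‖
  obtain ⟨k, hk⟩ := mem_iUnion.mp h
  refine ⟨k, Real.sqrt_le_iff.mpr ⟨norm_nonneg x, hk.1⟩, Real.lt_sqrt_of_sq_lt ?_⟩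
  push_cast
  exact hk.2

/-! ### Coverage in terms of the total mark -/

namespace Network

section Coverage

variable {Ω : Type*} {N : Network Ω} {p α T : ℝ} {s : Station} {ω : Ω}

lemma tsum_power (N : Network Ω) (p α : ℝ) (s : Station) (ω : Ω) :
    ∑' s' : {s' : Station // s' ≠ s}, N.power p α s'.1 ω = ENNReal.ofReal p *
      ∑' s' : {s' : Station // s' ≠ s},
        ENNReal.ofReal (N.fading s' ω) * ‖N.pos s' ω‖ₑ ^ (-α) := by
  rw [← ENNReal.tsum_mul_left]
  exact tsum_congr fun s' => by rw [power, mul_assoc]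

lemma shot_of_le {a : ℝ} (h : ∀ s' ≠ s, a ≤ ‖N.pos s' ω‖) :
    N.shot T α a s ω = ENNReal.ofReal (T * a ^ α) * ∑' s' : {s' : Station // s' ≠ s},
      ENNReal.ofReal (N.fading s' ω) * ‖N.pos s' ω‖ₑ ^ (-α) := by
  rw [shot, ← ENNReal.tsum_mul_left]
  exact tsum_congr fun s' => by rw [mark, if_neg (not_lt.mpr (h s' s'.2))]

/-- Being nearest leaves no other station closer than `a`, so no mark is infinite; lowering the
radius from ‖X‖ to `a` only lowers the threshold for the fading. -/
lemma shot_le_of_covered (hp : 0 < p) (hT : 0 < T) (hα : 2 < α) {a : ℝ} (ha : 0 ≤ a)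
    (hs : a ≤ ‖N.pos s ω‖) (hn : N.IsNearest s ω)
    (hc : ENNReal.ofReal T < N.sinr p α s ω) :
    N.shot T α a s ω ≤ ENNReal.ofReal (N.fading s ω) := by
  rw [shot_of_le fun s' _ => hs.trans (hn s')]
  -- At a = 0, the case of the innermost disc, the shot vanishes and nothing is to be shown.
  rcases eq_or_lt_of_le ha with h0 | h0
  · simp [← h0, Real.zero_rpow (by linarith : α ≠ 0)]
  have hr : 0 < ‖N.pos s ω‖ := h0.trans_le hs
  have h1 := ENNReal.mul_le_of_le_div hc.le
  rw [tsum_power, power, mul_assoc, mul_left_comm,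
    ENNReal.mul_le_mul_iff_right (by simpa using hp) ENNReal.ofReal_ne_top] at h1
  rw [ENNReal.ofReal_mul hT.le, mul_right_comm]
  refine (mul_le_mul' h1 le_rfl).trans ?_
  rw [mul_assoc]
  refine mul_le_of_le_one_right zero_le ?_
  rw [← ofReal_norm, ENNReal.ofReal_rpow_of_pos hr, ← ENNReal.ofReal_mul (by positivity),
    ENNReal.ofReal_le_one, Real.rpow_neg hr.le, inv_mul_le_one₀ (by positivity)]
  exact Real.rpow_le_rpow ha hs (by linarith)

/-- A station inside the ball would carry an infinite mark, which the finite fading cannot exceed.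
-/
lemma le_norm_of_shot_lt {b : ℝ} (h : N.shot T α b s ω < ENNReal.ofReal (N.fading s ω))
    {s' : Station} (hs' : s' ≠ s) : b ≤ ‖N.pos s' ω‖ := by
  by_contra! hlt
  have h1 := ENNReal.le_tsum (f := fun s' : {s' : Station // s' ≠ s} =>
    mark T α b (N.pos s' ω) (N.fading s' ω)) ⟨s', hs'⟩
  simp only [mark, if_pos hlt, top_le_iff] at h1
  have h2 : N.shot T α b s ω = ⊤ := h1
  rw [h2] at h
  exact not_top_lt h

/-- The other stations lie beyond `b`, hence beyond the serving one. Its power is at least the one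
it would deliver from distance `b`, which already beats T times the interference. -/
lemma covered_of_shot_lt (hp : 0 < p) (hT : 0 < T) (hα : 2 < α) {b : ℝ}
    (hs : 0 < ‖N.pos s ω‖) (hb : ‖N.pos s ω‖ ≤ b)
    (h : N.shot T α b s ω < ENNReal.ofReal (N.fading s ω)) :
    N.IsNearest s ω ∧ ENNReal.ofReal T < N.sinr p α s ω := by
  have hfar : ∀ s' ≠ s, b ≤ ‖N.pos s' ω‖ := fun s' hs' => le_norm_of_shot_lt h hs'
  have hb0 : 0 < b := hs.trans_le hb
  have hbα : 0 < b ^ (-α) := Real.rpow_pos_of_pos hb0 _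
  refine ⟨fun s' => ?_, ?_⟩
  · by_cases hs' : s' = s
    · rw [hs']
    · exact hb.trans (hfar s' hs')
  have henorm : ‖N.pos s ω‖ₑ ^ (-α) = ENNReal.ofReal (‖N.pos s ω‖ ^ (-α)) := by
    rw [← ofReal_norm, ENNReal.ofReal_rpow_of_pos hs]
  have hp0 : ENNReal.ofReal p ≠ 0 := by simpa using hp
  rw [sinr, ENNReal.lt_div_iff_mul_lt (Or.inr ENNReal.ofReal_ne_top)
      (Or.inr (by simpa using hT)), tsum_power, power, mul_assoc, mul_left_comm,
    ENNReal.mul_lt_mul_iff_right hp0 ENNReal.ofReal_ne_top]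
  rw [shot_of_le hfar] at h
  have h1 := ENNReal.mul_lt_mul_left (a := ENNReal.ofReal (b ^ (-α))) (by simpa using hbα)
    ENNReal.ofReal_ne_top h
  calc _ = ENNReal.ofReal (T * b ^ α) * (∑' s' : {s' : Station // s' ≠ s},
        ENNReal.ofReal (N.fading s' ω) * ‖N.pos s' ω‖ₑ ^ (-α)) * ENNReal.ofReal (b ^ (-α)) := by
        rw [mul_right_comm, ← ENNReal.ofReal_mul (by positivity), mul_assoc T, ← Real.rpow_add hb0]
        simp
    _ < ENNReal.ofReal (N.fading s ω) * ENNReal.ofReal (b ^ (-α)) := h1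
    _ ≤ _ := by
        rw [henorm]
        gcongr ENNReal.ofReal (N.fading s ω) * ENNReal.ofReal ?_
        exact Real.rpow_le_rpow_of_nonpos hs hb (by linarith)

end Coverage

/-! ### The coverage probability under the stationary law -/

namespace HasModelLaw

variable {Ω : Type*} [MeasurableSpace Ω] {N : Network Ω} {P : Measure Ω} [IsProbabilityMeasure P]
  {lamB lamU lamL muB : ℝ}

lemma measure_coveredByPlanar (hN : N.HasModelLaw P lamB lamU lamL muB) (hlamB : 0 < lamB)
    {p α T : ℝ} (hp : 0 < p) (hα : 2 < α) (hT : 0 < T) :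
    P (N.coveredByPlanar p α T) = ENNReal.ofReal (Real.pi * lamB) *
      ∫⁻ t in Ioi (0 : ℝ), N.laplace P lamB T α (Real.sqrt t) := by
  have hvol : ∀ δ : ℝ, 0 < δ → ∀ k, ENNReal.ofReal lamB * volume (annulus δ k)
      = ENNReal.ofReal (Real.pi * lamB * δ) := by
    intro δ hδ k
    rw [volume_annulus hδ, ← ENNReal.ofReal_mul hlamB.le]
    congr 1
    ring
  have hvol' : ∀ δ : ℝ, ENNReal.ofReal (Real.pi * lamB * δ)
      = ENNReal.ofReal (Real.pi * lamB) * ENNReal.ofReal δ := fun δ =>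
    ENNReal.ofReal_mul (by positivity)
  refine eq_mul_lintegral_of_riemann_bounds (Q := fun t => N.laplace P lamB T α (Real.sqrt t))
    ?_ (fun t => N.laplace_le_one P lamB T α _) ?_ ?_
  · exact fun s _ t _ hst => N.laplace_antitone P lamB hT hα (Real.sqrt_nonneg _)
      (Real.sqrt_le_sqrt hst)
  · intro δ hδ
    let U : ℕ → ℕ → Set Ω := fun k i => {ω | N.pos (Sum.inl i) ω ∈ annulus δ k ∧
      N.shot T α (Real.sqrt (k * δ)) (Sum.inl i) ω ≤ ENNReal.ofReal (N.fading (Sum.inl i) ω)}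
    have hsub : N.coveredByPlanar p α T ⊆ ⋃ k, ⋃ i, U k i := by
      rintro ω ⟨i, hn, hc⟩
      obtain ⟨k, hk⟩ := exists_mem_annulus hδ (N.pos (Sum.inl i) ω)
      exact mem_iUnion₂.mpr ⟨k, i, hk, shot_le_of_covered hp hT hα (Real.sqrt_nonneg _) hk.1 hn hc⟩
    calc _ ≤ expNeg (ENNReal.ofReal (Real.pi * lamB * δ)) * ∑' k, ∑' i, P (U k i) := by
          gcongr
          refine (measure_mono hsub).trans ((measure_iUnion_le _).trans ?_)
          exact ENNReal.tsum_le_tsum fun k => measure_iUnion_le _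
      _ = ∑' k : ℕ, expNeg (ENNReal.ofReal (Real.pi * lamB * δ)) * ∑' i, P (U k i) :=
          ENNReal.tsum_mul_left.symm
      _ ≤ ∑' k : ℕ, ENNReal.ofReal (Real.pi * lamB) *
            (ENNReal.ofReal δ * N.laplace P lamB T α (Real.sqrt (k * δ))) := by
          refine ENNReal.tsum_le_tsum fun k => ?_
          have := hN.sum_measure_serving_le hT hα (Real.sqrt_nonneg (k * δ))
            (measurableSet_annulus δ k) (by rw [hvol δ hδ]; exact ENNReal.ofReal_ne_top)
          rw [hvol δ hδ] at this
          rw [← mul_assoc, ← hvol']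
          exact this
      _ = _ := ENNReal.tsum_mul_left
  · intro δ hδ
    -- The innermost disc is skipped so that the serving station is at positive distance; the radius
    -- used is the outer one of annulus `q.1 + 1`.
    let U : ℕ × ℕ → Set Ω := fun q => {ω | N.pos (Sum.inl q.2) ω ∈ annulus δ (q.1 + 1) ∧
      N.shot T α (Real.sqrt ((q.1 + 2 : ℕ) * δ)) (Sum.inl q.2) ω
        < ENNReal.ofReal (N.fading (Sum.inl q.2) ω)}
    have hsub : ⋃ q, U q ⊆ N.coveredByPlanar p α T := by
      refine iUnion_subset fun q ω hω => ⟨q.2, ?_⟩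
      refine covered_of_shot_lt hp hT hα ?_ hω.1.2.le hω.2
      exact lt_of_lt_of_le (Real.sqrt_pos.mpr (by positivity)) hω.1.1
    have hUm : ∀ q, MeasurableSet (U q) := fun q =>
      (hN.measurable_pos _ (measurableSet_annulus δ _)).inter
        (measurableSet_lt (hN.measurable_shot T α _ _)
          (ENNReal.measurable_ofReal.comp (hN.fading_measurable _)))
    -- One station cannot lie in two annuli. Two different serving stations would each lie strictly
    -- inside the radius that the other keeps empty.
    have hUd : Pairwise (Function.onFun Disjoint U) := by
      rintro ⟨k, i⟩ ⟨l, j⟩ hne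
      refine Set.disjoint_left.mpr ?_
      rintro ω ⟨⟨hi1, hi2⟩, hi3⟩ ⟨⟨hj1, hj2⟩, hj3⟩
      by_cases hij : i = j
      · subst hij
        have hkl : k ≠ l := fun h => hne (by rw [h])
        have key : ∀ m n : ℕ, m < n → ∀ x : ℝ, x < Real.sqrt ((m + 1 + 1 : ℕ) * δ) →
            Real.sqrt ((n + 1 : ℕ) * δ) ≤ x → False := by
          intro m n hmn x hx hx'
          have : Real.sqrt ((m + 1 + 1 : ℕ) * δ) ≤ Real.sqrt ((n + 1 : ℕ) * δ) := by
            refine Real.sqrt_le_sqrt ?_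
            gcongr
            omega
          linarith
        rcases lt_or_gt_of_ne hkl with h | h
        · exact key k l h _ hi2 hj1
        · exact key l k h _ hj2 hi1
      · have h1 := le_norm_of_shot_lt hi3 (s' := Sum.inl j) (by simpa using Ne.symm hij)
        have h2 := le_norm_of_shot_lt hj3 (s' := Sum.inl i) (by simpa using hij)
        exact absurd (hi2.trans_le h1) (not_lt.mpr (hj2.trans_le h2).le)
    calc _ = ∑' k : ℕ, expNeg (ENNReal.ofReal (Real.pi * lamB * δ)) *
            (ENNReal.ofReal (Real.pi * lamB * δ) *
              N.laplace P lamB T α (Real.sqrt ((k + 2 : ℕ) * δ))) := by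
          simp_rw [hvol', mul_assoc, ENNReal.tsum_mul_left]
      _ ≤ ∑' k : ℕ, ∑' i : ℕ, P (U (k, i)) := by
          refine ENNReal.tsum_le_tsum fun k => ?_
          have := hN.le_sum_measure_serving hT hα (Real.sqrt_nonneg ((k + 2 : ℕ) * δ))
            (measurableSet_annulus δ (k + 1)) (by rw [hvol δ hδ]; exact ENNReal.ofReal_ne_top)
          rw [hvol δ hδ] at this
          exact this
      _ = P (⋃ q, U q) := by
          rw [measure_iUnion hUd hUm, ENNReal.tsum_prod']
      _ ≤ _ := measure_mono hsub

end HasModelLaw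

end Network

/-! ### Invariance under the flow and the Palm probability of the users -/

/-- The power received at the origin in a configuration of stations with fading. -/
def configPower (p α : ℝ) (v : (Station → Plane) × (Station → ℝ)) (s : Station) : ENNReal :=
  ENNReal.ofReal p * ENNReal.ofReal (v.2 s) * ‖v.1 s‖ₑ ^ (-α)

/-- The configurations of stations with fading whose nearest station is planar and has
signal-to-interference ratio above `T` at the origin. -/
def coveredConfigs (p α T : ℝ) : Set ((Station → Plane) × (Station → ℝ)) :=
  {v | ∃ i : ℕ, (∀ s', ‖v.1 (Sum.inl i)‖ ≤ ‖v.1 s'‖) ∧ ENNReal.ofReal T <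
    configPower p α v (Sum.inl i) /
      ∑' s' : {s' : Station // s' ≠ Sum.inl i}, configPower p α v s'}

lemma measurable_configPower (p α : ℝ) (s : Station) :
    Measurable fun v => configPower p α v s := by
  unfold configPower
  have h1 : Measurable fun v : (Station → Plane) × (Station → ℝ) => v.1 s := by fun_prop
  have h2 : Measurable fun v : (Station → Plane) × (Station → ℝ) => v.2 s := by fun_prop
  exact (measurable_const.mul (ENNReal.measurable_ofReal.comp h2)).mul (h1.enorm.pow_const _)

lemma measurableSet_coveredConfigs (p α T : ℝ) : MeasurableSet (coveredConfigs p α T) := by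
  have : coveredConfigs p α T = ⋃ i : ℕ, ((⋂ s', {v | ‖v.1 (Sum.inl i)‖ ≤ ‖v.1 s'‖}) ∩
      {v | ENNReal.ofReal T < configPower p α v (Sum.inl i) /
        ∑' s' : {s' : Station // s' ≠ Sum.inl i}, configPower p α v s'}) := by
    ext v
    simp [coveredConfigs]
  rw [this]
  refine MeasurableSet.iUnion fun i => (MeasurableSet.iInter fun s' => ?_).inter ?_
  · have h : ∀ s, Measurable fun v : (Station → Plane) × (Station → ℝ) => ‖v.1 s‖ := fun s =>
      Measurable.norm (by fun_prop)
    exact measurableSet_le (h _) (h _)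
  · exact measurableSet_lt measurable_const ((measurable_configPower p α _).div
      (Measurable.tsum fun s' => measurable_configPower p α _))

/-- Nearest station and interference do not depend on labels. The two kinds are permuted separately
because the event records that the server is planar. -/
lemma mem_coveredConfigs_of_relabel {p α T : ℝ} {v w : (Station → Plane) × (Station → ℝ)}
    (σ : Equiv.Perm ℕ) (τ : Equiv.Perm (ℕ × ℕ))
    (h : ∀ s, w.1 (Equiv.sumCongr σ τ s) = v.1 s ∧ w.2 (Equiv.sumCongr σ τ s) = v.2 s)
    (hv : v ∈ coveredConfigs p α T) : w ∈ coveredConfigs p α T := by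
  obtain ⟨i, hi, hT⟩ := hv
  let e : Equiv.Perm Station := Equiv.sumCongr σ τ
  have hpow : ∀ s, configPower p α w (e s) = configPower p α v s := fun s => by
    rw [configPower, configPower, (h s).1, (h s).2]
  have he : e (Sum.inl i) = Sum.inl (σ i) := rfl
  refine ⟨σ i, fun s' => ?_, ?_⟩
  · obtain ⟨s, rfl⟩ := e.surjective s'
    rw [← he, (h _).1, (h s).1]
    exact hi s
  · rw [← he, hpow]
    convert hT using 2
    let e' : {s : Station // s ≠ Sum.inl i} ≃ {s : Station // s ≠ e (Sum.inl i)} :=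
      e.subtypeEquiv fun s => by simp
    rw [← e'.tsum_eq]
    exact tsum_congr fun s => hpow s

lemma volume_unitSquare : volume unitSquare = 1 := by
  have h : unitSquare = (WithLp.ofLp : Plane → Fin 2 → ℝ) ⁻¹' (univ.pi fun _ => Ico (0 : ℝ) 1) := by
    ext x
    simp [unitSquare]
  rw [h, (PiLp.volume_preserving_ofLp (Fin 2)).measure_preimage
    (MeasurableSet.univ_pi fun _ => measurableSet_Ico).nullMeasurableSet, volume_pi_pi]
  simp

lemma measurableSet_unitSquare : MeasurableSet unitSquare := by
  have : unitSquare = ⋂ i, {x : Plane | x i ∈ Ico (0 : ℝ) 1} := by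
    ext x
    simp [unitSquare]
  rw [this]
  exact MeasurableSet.iInter fun i =>
    (show Measurable fun x : Plane => x i by fun_prop) measurableSet_Ico

namespace Network

variable {Ω : Type*} {N : Network Ω} {θ : Plane → Ω → Ω}

lemma IsCompatible.mem_coveredByPlanar_iff (hc : N.IsCompatible θ) (p α T : ℝ) (t : Plane)
    (ω : Ω) : θ t ω ∈ N.coveredByPlanar p α T ↔
      ((fun s => N.pos s ω - t, fun s => N.fading s ω) : (Station → Plane) × (Station → ℝ))
        ∈ coveredConfigs p α T := by
  obtain ⟨σ, hσ⟩ := hc.planar t ω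
  obtain ⟨τ, hτ⟩ := hc.vehicular t ω
  have h : ∀ s, N.pos (Equiv.sumCongr σ τ s) (θ t ω) = N.pos s ω - t ∧
      N.fading (Equiv.sumCongr σ τ s) (θ t ω) = N.fading s ω := by
    rintro (i | q)
    · exact hσ i
    · exact hτ q
  have hA : θ t ω ∈ N.coveredByPlanar p α T ↔
      ((fun s => N.pos s (θ t ω), fun s => N.fading s (θ t ω)) :
        (Station → Plane) × (Station → ℝ)) ∈ coveredConfigs p α T := Iff.rfl
  rw [hA]
  constructor
  · refine mem_coveredConfigs_of_relabel σ.symm τ.symm fun s => ?_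
    obtain ⟨s, rfl⟩ := (Equiv.sumCongr σ τ).surjective s
    rw [← Equiv.sumCongr_symm, Equiv.symm_apply_apply]
    exact ⟨(h s).1.symm, (h s).2.symm⟩
  · exact mem_coveredConfigs_of_relabel σ τ h

namespace HasModelLaw

variable [MeasurableSpace Ω] {P : Measure Ω} {lamB lamU lamL muB : ℝ}

lemma measurableSet_coveredByPlanar (hN : N.HasModelLaw P lamB lamU lamL muB) (p α T : ℝ) :
    MeasurableSet (N.coveredByPlanar p α T) :=
  ((measurable_pi_iff.mpr hN.measurable_pos).prodMk
    (measurable_pi_iff.mpr hN.fading_measurable)) (measurableSet_coveredConfigs p α T)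

variable [IsProbabilityMeasure P]

lemma meanIntensity_user (hN : N.HasModelLaw P lamB lamU lamL muB) :
    meanIntensity P N.user = ENNReal.ofReal lamU := by
  have h : (ENNReal.ofReal lamU • volume) unitSquare = ENNReal.ofReal lamU := by
    rw [Measure.smul_apply, volume_unitSquare, smul_eq_mul, mul_one]
  rw [meanIntensity, hN.user.lintegral_counting_eq measurableSet_unitSquare
    (by rw [h]; exact ENNReal.ofReal_ne_top), h]

/-- Compatibility turns coverage after the shift to the user into a statement about stations
translated by the user's position. That position is independent of the stations, so it may be frozen
at a value u. -/
lemma measure_user_shift (hN : N.HasModelLaw P lamB lamU lamL muB) (hθ : IsStationaryFlow P θ)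
    (hc : N.IsCompatible θ) (p α T : ℝ) (k : ℕ) :
    P ({ω | θ (N.user k ω) ω ∈ N.coveredByPlanar p α T} ∩ {ω | N.user k ω ∈ unitSquare})
      = P {ω | N.user k ω ∈ unitSquare} * P (N.coveredByPlanar p α T) := by
  let C := coveredConfigs p α T
  have hU := hN.user.measurable k
  let V : Ω → (Station → Plane) × (Station → ℝ) := fun ω => (fun s => N.pos s ω, fun s => N.fading s ω)
  have hV : Measurable V := (measurable_pi_iff.mpr hN.measurable_pos).prodMk
    (measurable_pi_iff.mpr hN.fading_measurable)
  have hind : IndepFun (N.user k) V P := by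
    refine hN.indepFun {Source.users} {Source.users}ᶜ disjoint_compl_right ?_
      (Measurable.prodMk ?_ ?_)
    · exact measurable_user_sigmaOf (mem_singleton _) k
    · exact measurable_pi_sigmaOf fun s => measurable_pos_sigmaOf (by simp) (by simp) (by simp) s
    · exact measurable_pi_sigmaOf fun s => measurable_fading_sigmaOf (by simp)
  let shift : Plane × ((Station → Plane) × (Station → ℝ)) → (Station → Plane) × (Station → ℝ) :=
    fun q => (fun s => q.2.1 s - q.1, q.2.2)
  have hshift : Measurable shift := by fun_prop
  have hF : Measurable fun q : Plane × ((Station → Plane) × (Station → ℝ)) =>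
      unitSquare.indicator (1 : Plane → ENNReal) q.1 *
        C.indicator (1 : (Station → Plane) × (Station → ℝ) → ENNReal) (shift q) :=
    ((measurable_one.indicator measurableSet_unitSquare).comp measurable_fst).mul
      ((measurable_one.indicator (measurableSet_coveredConfigs p α T)).comp hshift)
  have key := lintegral_of_indepFun hU hV hind
    (F := fun u v => unitSquare.indicator (1 : Plane → ENNReal) u *
      C.indicator (1 : (Station → Plane) × (Station → ℝ) → ENNReal) (shift (u, v))) hF
  have hinner : ∀ u : Plane, ∫⁻ ω, C.indicator
      (1 : (Station → Plane) × (Station → ℝ) → ENNReal) (shift (u, V ω)) ∂P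
      = P (N.coveredByPlanar p α T) := by
    intro u
    have hm : MeasurableSet {ω | shift (u, V ω) ∈ C} :=
      (hshift.comp (measurable_const.prodMk hV)) (measurableSet_coveredConfigs p α T)
    refine (lintegral_indicator_one hm).trans ?_
    -- For a fixed u, coverage by the translated stations is the preimage of coverage under `θ u`,
    -- which preserves `P`.
    rw [← (hθ.preserving u).measure_preimage
      (hN.measurableSet_coveredByPlanar p α T).nullMeasurableSet]
    congr 1
    ext ω
    exact (hc.mem_coveredByPlanar_iff p α T u ω).symm
  have hset : MeasurableSet
      ({ω | θ (N.user k ω) ω ∈ N.coveredByPlanar p α T} ∩ {ω | N.user k ω ∈ unitSquare}) :=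
    ((hθ.measurable.comp (hU.prodMk measurable_id))
      (hN.measurableSet_coveredByPlanar p α T)).inter (hU measurableSet_unitSquare)
  rw [← lintegral_indicator_one hset]
  calc _ = ∫⁻ ω, unitSquare.indicator (1 : Plane → ENNReal) (N.user k ω) *
        C.indicator (1 : (Station → Plane) × (Station → ℝ) → ENNReal) (shift (N.user k ω, V ω)) ∂P := by
        refine lintegral_congr fun ω => ?_
        have := hc.mem_coveredByPlanar_iff p α T (N.user k ω) ω
        rw [inter_comm, Set.inter_indicator_one, Pi.mul_apply]
        congr 1
        by_cases hω : θ (N.user k ω) ω ∈ N.coveredByPlanar p α T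
        · rw [indicator_of_mem (show ω ∈ {ω | θ (N.user k ω) ω ∈ N.coveredByPlanar p α T} from hω),
            indicator_of_mem (show shift (N.user k ω, V ω) ∈ C from this.mp hω)]
          rfl
        · rw [indicator_of_notMem
              (show ω ∉ {ω | θ (N.user k ω) ω ∈ N.coveredByPlanar p α T} from hω),
            indicator_of_notMem (show shift (N.user k ω, V ω) ∉ C from fun h => hω (this.mpr h))]
    _ = _ := by
        rw [key]
        have hi : Measurable fun ω => unitSquare.indicator (1 : Plane → ENNReal) (N.user k ω) :=
          (measurable_one.indicator measurableSet_unitSquare).comp hU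
        calc _ = ∫⁻ ω, unitSquare.indicator (1 : Plane → ENNReal) (N.user k ω) *
              P (N.coveredByPlanar p α T) ∂P := by
              refine lintegral_congr fun ω => ?_
              rw [lintegral_const_mul, hinner]
              exact (measurable_one.indicator (measurableSet_coveredConfigs p α T)).comp
                (hshift.comp (measurable_const.prodMk hV))
          _ = _ := by
              rw [lintegral_mul_const _ hi]
              congr 1
              exact lintegral_indicator_one (hU measurableSet_unitSquare)

/-- The users are independent of the base stations, hence coverage has the same probability under
the Palm probability of the users as under the stationary one. -/
lemma palm_coveredByPlanar (hN : N.HasModelLaw P lamB lamU lamL muB) (hlamU : 0 < lamU)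
    (hθ : IsStationaryFlow P θ) (hc : N.IsCompatible θ) (p α T : ℝ) :
    palm P θ N.user (N.coveredByPlanar p α T) = P (N.coveredByPlanar p α T) := by
  have hA := hN.measurableSet_coveredByPlanar p α T
  have hsum : ∑' k, P {ω | N.user k ω ∈ unitSquare} = ENNReal.ofReal lamU := by
    rw [← hN.meanIntensity_user, meanIntensity]
    simp_rw [counting_apply N.user _ measurableSet_unitSquare]
    have hi : ∀ k, Measurable fun ω => unitSquare.indicator (1 : Plane → ENNReal) (N.user k ω) :=
      fun k => (measurable_one.indicator measurableSet_unitSquare).comp (hN.user.measurable k)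
    rw [lintegral_tsum fun k => (hi k).aemeasurable]
    exact tsum_congr fun k =>
      (lintegral_indicator_one (hN.user.measurable k measurableSet_unitSquare)).symm
  rw [palm, Measure.smul_apply, Measure.sum_apply _ hA, smul_eq_mul, hN.meanIntensity_user]
  have hk : ∀ k, (P.restrict {ω | N.user k ω ∈ unitSquare}).map (fun ω => θ (N.user k ω) ω)
      (N.coveredByPlanar p α T)
      = P {ω | N.user k ω ∈ unitSquare} * P (N.coveredByPlanar p α T) := by
    intro k
    have hm : Measurable fun ω => θ (N.user k ω) ω :=
      hθ.measurable.comp ((hN.user.measurable k).prodMk measurable_id)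
    rw [Measure.map_apply hm hA, Measure.restrict_apply (hm hA)]
    exact hN.measure_user_shift hθ hc p α T k
  simp_rw [hk]
  rw [ENNReal.tsum_mul_right, hsum, ← mul_assoc, ENNReal.inv_mul_cancel (by simpa using hlamU)
    ENNReal.ofReal_ne_top, one_mul]

end HasModelLaw

end Network

/-! ### The Laplace functional of the vehicular base stations -/

lemma lintegral_even {F : ℝ → ENNReal} (hF : ∀ x, F (-x) = F x) :
    ∫⁻ x, F x = 2 * ∫⁻ x in Ioi (0 : ℝ), F x := by
  rw [← lintegral_add_compl F (measurableSet_Ioi (a := (0 : ℝ))), two_mul]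
  congr 1
  rw [compl_Ioi, ← setLIntegral_congr (Iio_ae_eq_Iic (a := (0 : ℝ)))]
  have h := (Measure.measurePreserving_neg (volume : Measure ℝ)).setLIntegral_comp_emb
    (Homeomorph.neg ℝ).measurableEmbedding F (Iio 0)
  have him : (fun x : ℝ => -x) '' Iio 0 = Ioi 0 := by simp
  rw [← him, ← h]
  exact lintegral_congr fun x => (hF x).symm

/-- The exponent of the Laplace transform of the losses on a line at distance `v`. -/
def lineLoss (muB T α a v : ℝ) : ENNReal :=
  ENNReal.ofReal muB * ∫⁻ t : ℝ, (1 - expNeg (loss T α a (Real.sqrt (v ^ 2 + t ^ 2))))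

lemma measurable_lineLoss (muB T α a : ℝ) : Measurable (lineLoss muB T α a) := by
  unfold lineLoss
  refine measurable_const.mul (Measurable.lintegral_prod_right'
    (f := fun q : ℝ × ℝ => 1 - expNeg (loss T α a (Real.sqrt (q.1 ^ 2 + q.2 ^ 2)))) ?_)
  refine measurable_const.sub (measurable_expNeg.comp ((measurable_loss T α a).comp ?_))
  fun_prop

lemma lineLoss_neg (muB T α a v : ℝ) : lineLoss muB T α a (-v) = lineLoss muB T α a v := by
  simp [lineLoss]

namespace Network

namespace HasModelLaw

variable {Ω : Type*} [MeasurableSpace Ω] {N : Network Ω} {P : Measure Ω} [IsProbabilityMeasure P]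
  {lamB lamU lamL muB : ℝ}

lemma lintegral_expNeg_line (hN : N.HasModelLaw P lamB lamU lamL muB) (T α a : ℝ) (i : ℕ)
    (l : ℝ × ℝ) :
    ∫⁻ ω, expNeg (∑' j, loss T α a ‖linePoint l (N.coord i j ω)‖) ∂P
      = expNeg (lineLoss muB T α a l.1) := by
  have := sigmaFinite_ofReal_smul muB (volume : Measure ℝ)
  have hm : Measurable fun t => loss T α a ‖linePoint l t‖ := by
    have hl : Measurable (linePoint l) := continuous_linePoint.measurable.comp measurable_prodMk_left
    exact (measurable_loss T α a).comp hl.norm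
  rw [(hN.coord i).lintegral_expNeg_tsum hm, lintegral_smul_measure, smul_eq_mul]
  simp_rw [norm_linePoint]
  rfl

/-- Given the lines, the processes on them are independent and each contributes e^{-lineLoss}, which
depends only on the distance of the line from the origin. The exponential formula for the line
process then applies to `lineLoss`. -/
lemma vehicularLaplace_eq (hN : N.HasModelLaw P lamB lamU lamL muB) (hlamL : 0 < lamL)
    (T α a : ℝ) :
    N.vehicularLaplace P T α a = expNeg (ENNReal.ofReal lamL *
      (2 * ∫⁻ v in Ioi (0 : ℝ), (1 - expNeg (lineLoss muB T α a v)))) := by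
  have hind : IndepFun (fun ω i => N.line i ω) (fun ω i j => N.coord i j ω) P := by
    refine hN.indepFun {Source.lines} {Source.lines}ᶜ disjoint_compl_right ?_ ?_
    · exact measurable_pi_sigmaOf fun i => measurable_line_sigmaOf (mem_singleton _) i
    · exact measurable_pi_sigmaOf fun i => measurable_pi_sigmaOf fun j =>
        measurable_coord_sigmaOf (by simp) j
  have hloss : ∀ {Ω' : Type _} [MeasurableSpace Ω'] {L : Ω' → ℝ × ℝ} {t : Ω' → ℝ},
      Measurable L → Measurable t → Measurable fun ω => loss T α a ‖linePoint (L ω) (t ω)‖ := by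
    intro Ω' _ L t hL ht
    have h : Measurable fun ω => linePoint (L ω) (t ω) :=
      continuous_linePoint.measurable.comp (hL.prodMk ht)
    exact (measurable_loss T α a).comp h.norm
  have hF : Measurable fun q : (ℕ → ℝ × ℝ) × (ℕ → ℕ → ℝ) =>
      expNeg (∑' i, ∑' j, loss T α a ‖linePoint (q.1 i) (q.2 i j)‖) :=
    measurable_expNeg.comp (Measurable.tsum fun i => Measurable.tsum fun j =>
      hloss (by fun_prop) (by fun_prop))
  have hline : Measurable fun ω i => N.line i ω := measurable_pi_iff.mpr hN.line.measurable
  have hcoord : Measurable fun ω i j => N.coord i j ω :=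
    measurable_pi_iff.mpr fun i => measurable_pi_iff.mpr (hN.coord i).measurable
  have key := lintegral_of_indepFun hline hcoord hind
    (F := fun l t => expNeg (∑' i, ∑' j, loss T α a ‖linePoint (l i) (t i j)‖)) hF
  have hinner : ∀ l : ℕ → ℝ × ℝ,
      ∫⁻ ω, expNeg (∑' i, ∑' j, loss T α a ‖linePoint (l i) (N.coord i j ω)‖) ∂P
        = expNeg (∑' i, lineLoss muB T α a (l i).1) := by
    intro l
    have hm : ∀ i, Measurable fun t : ℕ → ℝ => ∑' j, loss T α a ‖linePoint (l i) (t j)‖ :=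
      fun i => Measurable.tsum fun j => hloss measurable_const (measurable_pi_apply j)
    refine lintegral_expNeg_tsum_of_iIndepFun
      (Y := fun i ω => ∑' j, loss T α a ‖linePoint (l i) (N.coord i j ω)‖)
      (fun i => (hm i).comp (measurable_pi_iff.mpr (hN.coord i).measurable)) ?_ _
      fun i => hN.lintegral_expNeg_line T α a i (l i)
    exact hN.iIndepFun_coord.comp (fun i t => ∑' j, loss T α a ‖linePoint (l i) (t j)‖) hm
  have hsf := sigmaFinite_ofReal_smul (lamL / Real.pi)
    ((volume : Measure (ℝ × ℝ)).restrict (univ ×ˢ Ico 0 Real.pi))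
  have hg : Measurable fun v => 1 - expNeg (lineLoss muB T α a v) :=
    measurable_const.sub (measurable_expNeg.comp (measurable_lineLoss muB T α a))
  have hg' : Measurable fun l : ℝ × ℝ => 1 - expNeg (lineLoss muB T α a l.1) :=
    hg.comp measurable_fst
  calc N.vehicularLaplace P T α a
      = ∫⁻ ω, expNeg (∑' i, ∑' j, loss T α a ‖linePoint (N.line i ω) (N.coord i j ω)‖) ∂P := by
        refine lintegral_congr fun ω => ?_
        rw [ENNReal.tsum_prod']
        rfl
    _ = ∫⁻ ω, expNeg (∑' i, lineLoss muB T α a (N.line i ω).1) ∂P :=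
        key.trans (lintegral_congr fun ω => hinner _)
    _ = expNeg (∫⁻ l : ℝ × ℝ, (1 - expNeg (lineLoss muB T α a l.1))
          ∂(ENNReal.ofReal (lamL / Real.pi) • volume.restrict (univ ×ˢ Ico 0 Real.pi))) :=
        hN.line.lintegral_expNeg_tsum ((measurable_lineLoss muB T α a).comp measurable_fst)
    _ = _ := by
        congr 1
        rw [lintegral_smul_measure, smul_eq_mul, Measure.volume_eq_prod, ← Measure.prod_restrict,
          Measure.restrict_univ, lintegral_prod _ hg'.aemeasurable]
        simp only [lintegral_const, Measure.restrict_apply_univ, Real.volume_Ico, sub_zero]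
        -- The angle integrates to π, cancelling the normalization of the line intensity; evenness
        -- in the signed distance gives the factor 2.
        rw [lintegral_mul_const _ hg, mul_comm _ (ENNReal.ofReal Real.pi), ← mul_assoc,
          ← ENNReal.ofReal_mul (by positivity), div_mul_cancel₀ _ Real.pi_ne_zero,
          lintegral_even fun v => by rw [lineLoss_neg]]

end HasModelLaw

end Network

lemma disjoint_Ioo_Ici (a b : ℝ) : Disjoint (Ioo a b) (Ici b) :=
  Set.disjoint_left.mpr fun _ hx hx' => not_lt.mpr (mem_Ici.mp hx') hx.2

/-! ### Convergence of the integrals -/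

section Convergence

variable {muB T α r v : ℝ}

lemma one_sub_expNeg_loss_of_lt {ρ : ℝ} (h : ρ < r) : 1 - expNeg (loss T α r ρ) = 1 := by
  simp [loss, h]

lemma one_sub_expNeg_loss_of_le (hT : 0 < T) (hr : 0 < r) {ρ : ℝ} (h : r ≤ ρ) :
    1 - expNeg (loss T α r ρ)
      = ENNReal.ofReal (T * r ^ α * ρ ^ (-α) / (1 + T * r ^ α * ρ ^ (-α))) := by
  have hρ : 0 < ρ := hr.trans_le h
  have h0 : 0 < T * r ^ α * ρ ^ (-α) := by positivity
  rw [expNeg_loss hT hr.le h, ← ENNReal.ofReal_one, ← ENNReal.ofReal_sub _ (by positivity)]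
  congr 1
  field_simp
  ring

lemma planarTerm_eq (T α r : ℝ) {u : ℝ} (hu : 0 < u) :
    planarTerm T α r u = u * (T * r ^ α * u ^ (-α) / (1 + T * r ^ α * u ^ (-α))) := by
  rw [planarTerm, sub_eq_add_neg, Real.rpow_add hu, Real.rpow_one]
  ring

lemma lineTerm_eq (T α r v u : ℝ) : lineTerm T α r v u =
    T * r ^ α * Real.sqrt (v ^ 2 + u ^ 2) ^ (-α) /
      (1 + T * r ^ α * Real.sqrt (v ^ 2 + u ^ 2) ^ (-α)) := by
  have h : Real.sqrt (v ^ 2 + u ^ 2) ^ (-α) = (v ^ 2 + u ^ 2) ^ (-α / 2) := by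
    rw [Real.sqrt_eq_rpow, ← Real.rpow_mul (by positivity)]
    congr 1
    ring
  rw [h, lineTerm]

lemma div_one_add_le_self {x : ℝ} (hx : 0 ≤ x) : x / (1 + x) ≤ x :=
  div_le_self hx (by linarith)

lemma div_one_add_le_one {x : ℝ} (hx : 0 ≤ x) : x / (1 + x) ≤ 1 :=
  (div_le_one (by linarith)).mpr (by linarith)

lemma lineTerm_nonneg (hT : 0 < T) (hr : 0 < r) (v u : ℝ) : 0 ≤ lineTerm T α r v u := by
  unfold lineTerm
  positivity

lemma lineTerm_le_one (hT : 0 < T) (hr : 0 < r) (v u : ℝ) : lineTerm T α r v u ≤ 1 :=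
  div_one_add_le_one (by positivity)

lemma lineTerm_le (hT : 0 < T) (hα : 2 < α) (hr : 0 < r) {v u ρ : ℝ} (hρ : 0 < ρ)
    (h : ρ ^ 2 ≤ v ^ 2 + u ^ 2) : lineTerm T α r v u ≤ T * r ^ α * ρ ^ (-α) := by
  rw [lineTerm_eq]
  have h1 : ρ ≤ Real.sqrt (v ^ 2 + u ^ 2) := Real.le_sqrt_of_sq_le h
  refine (div_one_add_le_self (by positivity)).trans ?_
  gcongr T * r ^ α * ?_
  exact Real.rpow_le_rpow_of_nonpos hρ h1 (by linarith)

lemma measurable_lineTerm (T α r : ℝ) : Measurable fun q : ℝ × ℝ => lineTerm T α r q.1 q.2 := by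
  unfold lineTerm
  fun_prop

lemma integrableOn_const_mul_rpow_neg (C : ℝ) (hα : 2 < α) (hr : 0 < r) :
    IntegrableOn (fun u : ℝ => C * u ^ (-α)) (Ioi r) :=
  (integrableOn_Ioi_rpow_of_lt (by linarith) hr).const_mul C

lemma integrableOn_planarTerm (hT : 0 < T) (hα : 2 < α) (hr : 0 < r) :
    IntegrableOn (planarTerm T α r) (Ioi r) := by
  have hg : IntegrableOn (fun u : ℝ => T * r ^ α * u ^ (1 - α)) (Ioi r) :=
    (integrableOn_Ioi_rpow_of_lt (by linarith) hr).const_mul _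
  refine Integrable.mono' hg ?_ ?_
  · have : Measurable (planarTerm T α r) := by
      unfold planarTerm
      fun_prop
    exact this.aestronglyMeasurable
  · refine (ae_restrict_iff' measurableSet_Ioi).mpr (ae_of_all _ fun u hu => ?_)
    have hu0 : 0 < u := hr.trans hu
    have h0 : 0 ≤ T * r ^ α * u ^ (1 - α) := by positivity
    have h1 : 0 ≤ T * r ^ α * u ^ (-α) := by positivity
    rw [planarTerm, Real.norm_eq_abs, abs_of_nonneg (by positivity)]
    exact div_le_self h0 (by linarith)

lemma integrableOn_lineTerm_Ioi (hT : 0 < T) (hα : 2 < α) (hr : 0 < r) (v : ℝ) {s : ℝ}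
    (hs : 0 < s) : IntegrableOn (lineTerm T α r v) (Ioi s) := by
  refine Integrable.mono' (integrableOn_const_mul_rpow_neg (T * r ^ α) hα hs)
    ((measurable_lineTerm T α r).comp measurable_prodMk_left).aestronglyMeasurable ?_
  refine (ae_restrict_iff' measurableSet_Ioi).mpr (ae_of_all _ fun u hu => ?_)
  rw [Real.norm_eq_abs, abs_of_nonneg (lineTerm_nonneg hT hr v u)]
  exact lineTerm_le hT hα hr (hs.trans hu) (by nlinarith [sq_nonneg v])

lemma integrableOn_lineTerm_Ioc (hT : 0 < T) (hr : 0 < r) (v : ℝ) (s : ℝ) :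
    IntegrableOn (lineTerm T α r v) (Ioc 0 s) := by
  refine Integrable.mono' (g := fun _ => (1 : ℝ)) (by simp)
    ((measurable_lineTerm T α r).comp measurable_prodMk_left).aestronglyMeasurable ?_
  refine ae_of_all _ fun u => ?_
  rw [Real.norm_eq_abs, abs_of_nonneg (lineTerm_nonneg hT hr v u)]
  exact lineTerm_le_one hT hr v u

lemma integrableOn_lineTerm (hT : 0 < T) (hα : 2 < α) (hr : 0 < r) (v : ℝ) :
    IntegrableOn (lineTerm T α r v) (Ioi 0) := by
  rw [← Ioc_union_Ioi_eq_Ioi zero_le_one]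
  exact (integrableOn_lineTerm_Ioc hT hr v 1).union
    (integrableOn_lineTerm_Ioi hT hα hr v one_pos)

/-- Up to height v the distance to the origin is bounded below by v, and beyond it by u. Both pieces
are of order v^(1-α), which is integrable at infinity because α > 2. -/
lemma integral_lineTerm_le (hT : 0 < T) (hα : 2 < α) (hr : 0 < r) (hv : 0 < v) :
    ∫ u in Ioi (0 : ℝ), lineTerm T α r v u
      ≤ T * r ^ α * (1 + 1 / (α - 1)) * v ^ (1 - α) := by
  have hv1 : v ^ (1 - α) = v * v ^ (-α) := by
    rw [sub_eq_add_neg, Real.rpow_add hv, Real.rpow_one]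
  rw [← Ioc_union_Ioi_eq_Ioi hv.le, setIntegral_union Ioc_disjoint_Ioi_same measurableSet_Ioi
    (integrableOn_lineTerm_Ioc hT hr v v)
    (integrableOn_lineTerm_Ioi hT hα hr v hv)]
  have h1 : ∫ u in Ioc 0 v, lineTerm T α r v u ≤ T * r ^ α * v ^ (1 - α) := by
    calc ∫ u in Ioc 0 v, lineTerm T α r v u ≤ ∫ _ in Ioc 0 v, T * r ^ α * v ^ (-α) := by
          refine setIntegral_mono_on (integrableOn_lineTerm_Ioc hT hr v v)
            (integrable_const _)
            measurableSet_Ioc fun u _ => lineTerm_le hT hα hr hv (by nlinarith [sq_nonneg u])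
      _ = T * r ^ α * v ^ (1 - α) := by
          rw [setIntegral_const, Measure.real, Real.volume_Ioc, sub_zero,
            ENNReal.toReal_ofReal hv.le, smul_eq_mul, hv1]
          ring
  have h2 : ∫ u in Ioi v, lineTerm T α r v u ≤ T * r ^ α * (1 / (α - 1)) * v ^ (1 - α) := by
    calc ∫ u in Ioi v, lineTerm T α r v u ≤ ∫ u in Ioi v, T * r ^ α * u ^ (-α) := by
          refine setIntegral_mono_on (integrableOn_lineTerm_Ioi hT hα hr v hv)
            (integrableOn_const_mul_rpow_neg _ hα hv) measurableSet_Ioi fun u hu =>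
            lineTerm_le hT hα hr (hv.trans hu) (by nlinarith [sq_nonneg v])
      _ = T * r ^ α * (1 / (α - 1)) * v ^ (1 - α) := by
          rw [integral_const_mul, integral_Ioi_rpow_of_lt (by linarith) hv]
          have : -α + 1 = 1 - α := by ring
          rw [this]
          have h3 : 1 - α ≠ 0 := by linarith
          have h4 : α - 1 ≠ 0 := by linarith
          field_simp
          ring
  calc _ ≤ T * r ^ α * v ^ (1 - α) + T * r ^ α * (1 / (α - 1)) * v ^ (1 - α) := add_le_add h1 h2
    _ = _ := by ring

lemma avoidTerm_nonneg (hmuB : 0 < muB) (hT : 0 < T) (hr : 0 < r) (v : ℝ) :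
    0 ≤ avoidTerm muB T α r v := by
  have h : 0 ≤ ∫ u in Ioi (0 : ℝ), lineTerm T α r v u :=
    integral_nonneg fun u => lineTerm_nonneg hT hr v u
  have : 0 ≤ muB * ∫ u in Ioi (0 : ℝ), lineTerm T α r v u := by positivity
  rw [avoidTerm, sub_nonneg, Real.exp_le_one_iff]
  linarith

lemma hitTerm_nonneg (hmuB : 0 < muB) (hT : 0 < T) (hr : 0 < r) (v : ℝ) :
    0 ≤ hitTerm muB T α r v := by
  have h : 0 ≤ ∫ u in Ioi (Real.sqrt (r ^ 2 - v ^ 2)), lineTerm T α r v u :=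
    integral_nonneg fun u => lineTerm_nonneg hT hr v u
  have h1 : 0 ≤ muB * ∫ u in Ioi (Real.sqrt (r ^ 2 - v ^ 2)), lineTerm T α r v u := by positivity
  have h2 : 0 ≤ muB * Real.sqrt (r ^ 2 - v ^ 2) := by positivity
  rw [hitTerm, sub_nonneg, Real.exp_le_one_iff]
  linarith

lemma integrableOn_avoidTerm (hmuB : 0 < muB) (hT : 0 < T) (hα : 2 < α) (hr : 0 < r) :
    IntegrableOn (avoidTerm muB T α r) (Ioi r) := by
  have hg : IntegrableOn (fun v : ℝ => 2 * muB * (T * r ^ α * (1 + 1 / (α - 1))) * v ^ (1 - α))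
      (Ioi r) := (integrableOn_Ioi_rpow_of_lt (by linarith) hr).const_mul _
  refine Integrable.mono' hg ?_ ?_
  · have h : StronglyMeasurable fun v => ∫ u in Ioi (0 : ℝ), lineTerm T α r v u :=
      (measurable_lineTerm T α r).stronglyMeasurable.integral_prod_right'
    have : Measurable (avoidTerm muB T α r) :=
      measurable_const.sub (Real.measurable_exp.comp (h.measurable.const_mul _))
    exact this.aestronglyMeasurable
  · refine (ae_restrict_iff' measurableSet_Ioi).mpr (ae_of_all _ fun v hv => ?_)
    rw [Real.norm_eq_abs, abs_of_nonneg (avoidTerm_nonneg hmuB hT hr v)]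
    have h1 := integral_lineTerm_le hT hα hr (hr.trans hv)
    -- This gives 1 - e^{-x} ≤ x, so the decay of the inner integral carries over to `avoidTerm`.
    have h2 := Real.add_one_le_exp (-2 * muB * ∫ u in Ioi (0 : ℝ), lineTerm T α r v u)
    have h3 := mul_le_mul_of_nonneg_left h1 hmuB.le
    rw [avoidTerm]
    linarith

lemma integrableOn_hitTerm (hmuB : 0 < muB) (hT : 0 < T) (hr : 0 < r) :
    IntegrableOn (hitTerm muB T α r) (Ioo 0 r) := by
  refine Integrable.mono' (g := fun _ => (1 : ℝ)) (by simp) ?_ (ae_of_all _ fun v => ?_)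
  · have hS : MeasurableSet {q : ℝ × ℝ | Real.sqrt (r ^ 2 - q.1 ^ 2) < q.2} :=
      measurableSet_lt (by fun_prop) measurable_snd
    have h : StronglyMeasurable fun v => ∫ u,
        {q : ℝ × ℝ | Real.sqrt (r ^ 2 - q.1 ^ 2) < q.2}.indicator
          (fun q => lineTerm T α r q.1 q.2) (v, u) :=
      ((measurable_lineTerm T α r).indicator hS).stronglyMeasurable.integral_prod_right'
    have h' : Measurable fun v =>
        ∫ u in Ioi (Real.sqrt (r ^ 2 - v ^ 2)), lineTerm T α r v u := by
      convert h.measurable using 2 with v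
      rw [← integral_indicator measurableSet_Ioi]
      rfl
    have : Measurable (hitTerm muB T α r) := by
      refine measurable_const.sub (Real.measurable_exp.comp (Measurable.sub ?_ (h'.const_mul _)))
      fun_prop
    exact this.aestronglyMeasurable
  · rw [Real.norm_eq_abs, abs_of_nonneg (hitTerm_nonneg hmuB hT hr v), hitTerm]
    linarith [Real.exp_pos (-2 * muB * Real.sqrt (r ^ 2 - v ^ 2)
      - 2 * muB * ∫ u in Ioi (Real.sqrt (r ^ 2 - v ^ 2)), lineTerm T α r v u)]

/-! ### Evaluation of the exponents -/

/-- Polar coordinates: the integrand equals 1 inside the ball, giving the area π r², and the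
Jacobian outside it produces `planarTerm`. -/
lemma planarLoss_eq (hT : 0 < T) (hα : 2 < α) (hr : 0 < r) :
    planarLoss T α r = ENNReal.ofReal
      (Real.pi * r ^ 2 + 2 * Real.pi * ∫ u in Ioi r, planarTerm T α r u) := by
  let f : ℝ → ℝ := fun ρ =>
    if ρ < r then 1 else T * r ^ α * ρ ^ (-α) / (1 + T * r ^ α * ρ ^ (-α))
  have hf0 : ∀ ρ, 0 ≤ ρ → 0 ≤ f ρ := by
    intro ρ hρ
    simp only [f]
    split_ifs
    · exact zero_le_one
    · positivity
  have hloss : ∀ ρ, 1 - expNeg (loss T α r ρ) = ENNReal.ofReal (f ρ) := by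
    intro ρ
    by_cases h : ρ < r
    · rw [one_sub_expNeg_loss_of_lt h]; simp [f, h]
    · rw [one_sub_expNeg_loss_of_le hT hr (not_lt.mp h)]; simp [f, h]
  have hin : EqOn (fun y : ℝ => y ^ (Module.finrank ℝ Plane - 1) • f y) (fun y => y) (Ioo 0 r) := by
    intro y hy
    simp [f, hy.2]
  have hout : EqOn (fun y : ℝ => y ^ (Module.finrank ℝ Plane - 1) • f y) (planarTerm T α r)
      (Ici r) := by
    intro y hy
    rw [planarTerm_eq T α r (hr.trans_le hy)]
    simp [f, not_lt.mpr (mem_Ici.mp hy)]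
  have hid : IntegrableOn (fun y : ℝ => y) (Ioo 0 r) :=
    (continuous_id.integrableOn_Icc (a := 0) (b := r)).mono_set Ioo_subset_Icc_self
  have hpl : IntegrableOn (planarTerm T α r) (Ici r) :=
    (integrableOn_planarTerm hT hα hr).congr_set_ae Ioi_ae_eq_Ici.symm
  have h1 := (integrableOn_congr_fun hin measurableSet_Ioo).mpr hid
  have h2 := (integrableOn_congr_fun hout measurableSet_Ici).mpr hpl
  have hU : Ioo 0 r ∪ Ici r = Ioi (0 : ℝ) := Ioo_union_Ici_eq_Ioi hr
  have hint : Integrable (fun x : Plane => f ‖x‖) := by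
    rw [integrable_fun_norm_addHaar, ← hU]
    exact h1.union h2
  have hval : ∫ x : Plane, f ‖x‖
      = Real.pi * r ^ 2 + 2 * Real.pi * ∫ u in Ioi r, planarTerm T α r u := by
    rw [integral_fun_norm_addHaar, ← hU, setIntegral_union (disjoint_Ioo_Ici 0 r) measurableSet_Ici h1 h2,
      setIntegral_congr_fun measurableSet_Ioo hin,
      setIntegral_congr_fun measurableSet_Ici hout, integral_Ici_eq_integral_Ioi,
      ← integral_Ioc_eq_integral_Ioo, ← intervalIntegral.integral_of_le hr.le, integral_id,
      Measure.real, EuclideanSpace.volume_ball_fin_two]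
    simp [Real.pi_pos.le]
    ring
  rw [planarLoss, ← hval, ofReal_integral_eq_lintegral_ofReal hint
    (ae_of_all _ fun x => hf0 _ (norm_nonneg x))]
  exact lintegral_congr fun x => hloss _

lemma lineLoss_eq_lintegral_Ioi (muB T α r v : ℝ) : lineLoss muB T α r v = ENNReal.ofReal muB *
    (2 * ∫⁻ t in Ioi (0 : ℝ), (1 - expNeg (loss T α r (Real.sqrt (v ^ 2 + t ^ 2))))) := by
  rw [lineLoss, lintegral_even fun t => by rw [neg_sq]]

lemma one_sub_expNeg_ofReal {x : ℝ} (hx : 0 ≤ x) :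
    1 - expNeg (ENNReal.ofReal x) = ENNReal.ofReal (1 - Real.exp (-x)) := by
  rw [expNeg_ofReal hx, ← ENNReal.ofReal_one, ← ENNReal.ofReal_sub _ (Real.exp_nonneg _)]

lemma lintegral_loss_of_far (hT : 0 < T) (hα : 2 < α) (hr : 0 < r) {s : ℝ} (hs : 0 ≤ s)
    (h : ∀ t, s < t → r ≤ Real.sqrt (v ^ 2 + t ^ 2)) :
    ∫⁻ t in Ioi s, (1 - expNeg (loss T α r (Real.sqrt (v ^ 2 + t ^ 2))))
      = ENNReal.ofReal (∫ u in Ioi s, lineTerm T α r v u) := by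
  have hi : IntegrableOn (lineTerm T α r v) (Ioi s) :=
    (integrableOn_lineTerm hT hα hr v).mono_set (Ioi_subset_Ioi hs)
  rw [ofReal_integral_eq_lintegral_ofReal hi (ae_of_all _ fun u => lineTerm_nonneg hT hr v u)]
  refine setLIntegral_congr_fun measurableSet_Ioi fun t ht => ?_
  rw [one_sub_expNeg_loss_of_le hT hr (h t ht), lineTerm_eq]

lemma one_sub_expNeg_lineLoss_of_gt (hmuB : 0 < muB) (hT : 0 < T) (hα : 2 < α) (hr : 0 < r)
    (hv : r < v) : 1 - expNeg (lineLoss muB T α r v) = ENNReal.ofReal (avoidTerm muB T α r v) := by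
  have hI : 0 ≤ ∫ u in Ioi (0 : ℝ), lineTerm T α r v u :=
    integral_nonneg fun u => lineTerm_nonneg hT hr v u
  have he : lineLoss muB T α r v
      = ENNReal.ofReal (2 * muB * ∫ u in Ioi (0 : ℝ), lineTerm T α r v u) := by
    rw [lineLoss_eq_lintegral_Ioi, lintegral_loss_of_far hT hα hr le_rfl, ← mul_assoc,
      ENNReal.ofReal_mul (by positivity), ENNReal.ofReal_mul zero_le_two, ENNReal.ofReal_ofNat,
      mul_comm (2 : ENNReal)]
    exact fun t _ => Real.le_sqrt_of_sq_le (by nlinarith [sq_nonneg t])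
  rw [he, one_sub_expNeg_ofReal (by positivity), avoidTerm]
  congr 3
  ring

/-- The line meets the ball in a chord of half-length √(r² - v²), where the integrand is 1; beyond
the chord it is `lineTerm`. -/
lemma one_sub_expNeg_lineLoss_of_lt (hmuB : 0 < muB) (hT : 0 < T) (hα : 2 < α) (hr : 0 < r)
    (hv0 : 0 < v) (hv : v < r) :
    1 - expNeg (lineLoss muB T α r v) = ENNReal.ofReal (hitTerm muB T α r v) := by
  set s := Real.sqrt (r ^ 2 - v ^ 2) with hs
  have hs2 : s ^ 2 = r ^ 2 - v ^ 2 := Real.sq_sqrt (by nlinarith)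
  have hs0 : 0 < s := Real.sqrt_pos.mpr (by nlinarith)
  have hI : 0 ≤ ∫ u in Ioi s, lineTerm T α r v u :=
    integral_nonneg fun u => lineTerm_nonneg hT hr v u
  have he : lineLoss muB T α r v
      = ENNReal.ofReal (2 * muB * (s + ∫ u in Ioi s, lineTerm T α r v u)) := by
    have hnear : ∫⁻ t in Ioo 0 s, (1 - expNeg (loss T α r (Real.sqrt (v ^ 2 + t ^ 2))))
        = ENNReal.ofReal s := by
      rw [setLIntegral_congr_fun (g := fun _ => 1) measurableSet_Ioo fun t ht => ?_]
      · simp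
      · refine one_sub_expNeg_loss_of_lt ((Real.sqrt_lt' hr).mpr ?_)
        nlinarith [ht.1, ht.2]
    have hsplit : Ioo 0 s ∪ Ici s = Ioi (0 : ℝ) := Ioo_union_Ici_eq_Ioi hs0
    rw [lineLoss_eq_lintegral_Ioi, ← hsplit, lintegral_union measurableSet_Ici
      (disjoint_Ioo_Ici 0 s), hnear,
      setLIntegral_congr (Ioi_ae_eq_Ici (a := s)).symm,
      lintegral_loss_of_far hT hα hr hs0.le, ← ENNReal.ofReal_add hs0.le hI, ← mul_assoc,
      ENNReal.ofReal_mul (by positivity), ENNReal.ofReal_mul zero_le_two, ENNReal.ofReal_ofNat,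
      mul_comm (2 : ENNReal)]
    exact fun t ht => Real.le_sqrt_of_sq_le (by nlinarith)
  rw [he, one_sub_expNeg_ofReal (by positivity), hitTerm, ← hs]
  congr 3
  ring

lemma lintegral_lineLoss (hmuB : 0 < muB) (hT : 0 < T) (hα : 2 < α) (hr : 0 < r) :
    ∫⁻ v in Ioi (0 : ℝ), (1 - expNeg (lineLoss muB T α r v))
      = ENNReal.ofReal ((∫ v in Ioi r, avoidTerm muB T α r v)
        + ∫ v in Ioo 0 r, hitTerm muB T α r v) := by
  have hsplit : Ioo 0 r ∪ Ici r = Ioi (0 : ℝ) := Ioo_union_Ici_eq_Ioi hr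
  have h1 : ∫⁻ v in Ioi r, (1 - expNeg (lineLoss muB T α r v))
      = ENNReal.ofReal (∫ v in Ioi r, avoidTerm muB T α r v) := by
    rw [ofReal_integral_eq_lintegral_ofReal (integrableOn_avoidTerm hmuB hT hα hr)
      (ae_of_all _ fun v => avoidTerm_nonneg hmuB hT hr v)]
    exact setLIntegral_congr_fun measurableSet_Ioi fun v hv =>
      one_sub_expNeg_lineLoss_of_gt hmuB hT hα hr hv
  have h2 : ∫⁻ v in Ioo 0 r, (1 - expNeg (lineLoss muB T α r v))
      = ENNReal.ofReal (∫ v in Ioo 0 r, hitTerm muB T α r v) := by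
    rw [ofReal_integral_eq_lintegral_ofReal (integrableOn_hitTerm hmuB hT hr)
      (ae_of_all _ fun v => hitTerm_nonneg hmuB hT hr v)]
    exact setLIntegral_congr_fun measurableSet_Ioo fun v hv =>
      one_sub_expNeg_lineLoss_of_lt hmuB hT hα hr hv.1 hv.2
  rw [← hsplit, lintegral_union measurableSet_Ici
    (disjoint_Ioo_Ici 0 r),
    setLIntegral_congr (Ioi_ae_eq_Ici (a := r)).symm, h1, h2, add_comm, ← ENNReal.ofReal_add]
  · exact integral_nonneg fun v => avoidTerm_nonneg hmuB hT hr v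
  · exact integral_nonneg fun v => hitTerm_nonneg hmuB hT hr v

end Convergence

/-! ### From squared radius to radius, and the coverage density -/

lemma lintegral_comp_sqrt (Q : ℝ → ENNReal) :
    ∫⁻ t in Ioi (0 : ℝ), Q (Real.sqrt t) = ∫⁻ r in Ioi (0 : ℝ), ENNReal.ofReal (2 * r) * Q r := by
  have himg : (fun r : ℝ => r ^ 2) '' Ioi 0 = Ioi 0 := by
    ext t
    constructor
    · rintro ⟨r, hr, rfl⟩
      exact pow_pos (mem_Ioi.mp hr) 2
    · intro ht
      exact ⟨Real.sqrt t, Real.sqrt_pos.mpr ht, Real.sq_sqrt (le_of_lt ht)⟩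
  have hinj : InjOn (fun r : ℝ => r ^ 2) (Ioi 0) := fun a ha b hb hab =>
    (pow_left_inj₀ (le_of_lt ha) (le_of_lt hb) two_ne_zero).mp hab
  have h := lintegral_image_eq_lintegral_abs_deriv_mul (s := Ioi (0 : ℝ))
    (f := fun r => r ^ 2) (f' := fun r => 2 * r) measurableSet_Ioi
    (fun r _ => by simpa using (hasDerivAt_pow 2 r).hasDerivWithinAt) hinj
    (fun t => Q (Real.sqrt t))
  rw [himg] at h
  rw [h]
  refine setLIntegral_congr_fun measurableSet_Ioi fun r hr => ?_
  have hr' : 0 ≤ r := le_of_lt hr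
  simp only [Real.sqrt_sq hr', abs_of_nonneg (mul_nonneg zero_le_two hr')]

namespace Network

namespace HasModelLaw

variable {Ω : Type*} [MeasurableSpace Ω] {N : Network Ω} {P : Measure Ω} [IsProbabilityMeasure P]
  {lamB lamU lamL muB : ℝ}

lemma ofReal_coverageDensity (hN : N.HasModelLaw P lamB lamU lamL muB) (hlamB : 0 < lamB)
    (hlamL : 0 < lamL) (hmuB : 0 < muB) {α T r : ℝ} (hα : 2 < α) (hT : 0 < T) (hr : 0 < r) :
    ENNReal.ofReal (coverageDensity lamB lamL muB T α r)
      = ENNReal.ofReal (Real.pi * lamB) * (ENNReal.ofReal (2 * r) * N.laplace P lamB T α r) := by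
  have hI : 0 ≤ ∫ u in Ioi r, planarTerm T α r u := by
    refine setIntegral_nonneg measurableSet_Ioi fun u hu => ?_
    have : 0 < u := hr.trans hu
    unfold planarTerm
    positivity
  have hA : 0 ≤ ∫ v in Ioi r, avoidTerm muB T α r v :=
    integral_nonneg fun v => avoidTerm_nonneg hmuB hT hr v
  have hB : 0 ≤ ∫ v in Ioo 0 r, hitTerm muB T α r v :=
    integral_nonneg fun v => hitTerm_nonneg hmuB hT hr v
  rw [laplace, hN.vehicularLaplace_eq hlamL, lintegral_lineLoss hmuB hT hα hr,
    planarLoss_eq hT hα hr, ← ENNReal.ofReal_mul hlamB.le, ← ENNReal.ofReal_ofNat 2,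
    ← ENNReal.ofReal_mul zero_le_two, ← ENNReal.ofReal_mul hlamL.le,
    expNeg_ofReal (by positivity), expNeg_ofReal (by positivity),
    ← ENNReal.ofReal_mul (by positivity), ← ENNReal.ofReal_mul (by positivity),
    ← ENNReal.ofReal_mul (by positivity), coverageDensity]
  congr 1
  rw [mul_assoc, mul_assoc, mul_assoc, ← Real.exp_add, ← Real.exp_add, ← Real.exp_add,
    ← Real.exp_add]
  ring_nf

end HasModelLaw

end Network

end CoxCellular

end

/-! ### The coverage formula under the Palm probability -/

theorem lemma1 {Ω : Type*} [MeasurableSpace Ω] (P : MeasureTheory.Measure Ω)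
    [MeasureTheory.IsProbabilityMeasure P]
    (θ : CoxCellular.Plane → Ω → Ω) (hθ : CoxCellular.IsStationaryFlow P θ)
    (lamB lamU lamL muB : ℝ) (hlamB : 0 < lamB) (hlamU : 0 < lamU) (hlamL : 0 < lamL)
    (hmuB : 0 < muB)
    (N : CoxCellular.Network Ω) (hN : N.HasModelLaw P lamB lamU lamL muB)
    (hc : N.IsCompatible θ)
    (p α T : ℝ) (hp : 0 < p) (hα : 2 < α) (hT : 0 < T) :
    -- every integral in the formula converges
    (∀ r : ℝ, 0 < r →
      MeasureTheory.IntegrableOn (CoxCellular.planarTerm T α r) (Set.Ioi r) ∧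
      (∀ v : ℝ, 0 ≤ v →
        MeasureTheory.IntegrableOn (CoxCellular.lineTerm T α r v) (Set.Ioi 0)) ∧
      MeasureTheory.IntegrableOn (CoxCellular.avoidTerm muB T α r) (Set.Ioi r) ∧
      MeasureTheory.IntegrableOn (CoxCellular.hitTerm muB T α r) (Set.Ioo 0 r)) ∧
    MeasureTheory.IntegrableOn (CoxCellular.coverageDensity lamB lamL muB T α) (Set.Ioi 0) ∧
    -- the coverage probability of the typical planar user by a planar base station
    CoxCellular.palm P θ N.user (N.coveredByPlanar p α T) =
      ENNReal.ofReal
        (∫ r in Set.Ioi (0 : ℝ), CoxCellular.coverageDensity lamB lamL muB T α r) := by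
  refine ⟨fun r hr => ⟨CoxCellular.integrableOn_planarTerm hT hα hr,
    fun v _ => CoxCellular.integrableOn_lineTerm hT hα hr v,
    CoxCellular.integrableOn_avoidTerm hmuB hT hα hr,
    CoxCellular.integrableOn_hitTerm hmuB hT hr⟩, ?_⟩
  set Q : ℝ → ENNReal := N.laplace P lamB T α
  have hnonneg : ∀ r, 0 < r → 0 ≤ CoxCellular.coverageDensity lamB lamL muB T α r := by
    intro r hr
    unfold CoxCellular.coverageDensity
    positivity
  have hdens : ∀ r, 0 < r →
      ENNReal.ofReal (CoxCellular.coverageDensity lamB lamL muB T α r)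
        = ENNReal.ofReal (Real.pi * lamB) * (ENNReal.ofReal (2 * r) * Q r) := fun r hr =>
    hN.ofReal_coverageDensity hlamB hlamL hmuB hα hT hr
  -- Monotonicity in the radius gives measurability of the density without examining its parametric
  -- integrals.
  have hQ : AEMeasurable Q (volume.restrict (Set.Ioi 0)) :=
    aemeasurable_restrict_of_antitoneOn measurableSet_Ioi fun a ha b _ hab =>
      N.laplace_antitone P lamB hT hα (le_of_lt ha) hab
  have hR : AEMeasurable (fun r => ENNReal.ofReal (2 * r) * Q r) (volume.restrict (Set.Ioi 0)) :=
    AEMeasurable.mul (by fun_prop) hQ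
  have hP : P (N.coveredByPlanar p α T) = ∫⁻ r in Set.Ioi (0 : ℝ),
      ENNReal.ofReal (CoxCellular.coverageDensity lamB lamL muB T α r) := by
    rw [hN.measure_coveredByPlanar hlamB hp hα hT, CoxCellular.lintegral_comp_sqrt,
      ← lintegral_const_mul'' _ hR]
    exact setLIntegral_congr_fun measurableSet_Ioi fun r hr => (hdens r hr).symm
  have hmeas : AEStronglyMeasurable (CoxCellular.coverageDensity lamB lamL muB T α)
      (volume.restrict (Set.Ioi 0)) := by
    refine AEMeasurable.aestronglyMeasurable (AEMeasurable.congr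
      (f := fun r => (ENNReal.ofReal (Real.pi * lamB) * (ENNReal.ofReal (2 * r) * Q r)).toReal)
      (hR.const_mul _).ennreal_toReal ?_)
    refine (ae_restrict_iff' measurableSet_Ioi).mpr (ae_of_all _ fun r hr => ?_)
    simp only [← hdens r hr, ENNReal.toReal_ofReal (hnonneg r hr)]
  have hae : 0 ≤ᵐ[volume.restrict (Set.Ioi 0)] CoxCellular.coverageDensity lamB lamL muB T α :=
    (ae_restrict_iff' measurableSet_Ioi).mpr (ae_of_all _ hnonneg)
  -- The density is nonnegative and its total integral is a probability, hence finite.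
  have hint : IntegrableOn (CoxCellular.coverageDensity lamB lamL muB T α) (Set.Ioi 0) := by
    refine ⟨hmeas, (hasFiniteIntegral_iff_ofReal hae).mpr ?_⟩
    rw [← hP]
    exact measure_lt_top P _
  exact ⟨hint, by rw [hN.palm_coveredByPlanar hlamU hθ hc, hP,
    ofReal_integral_eq_lintegral_ofReal hint hae]⟩
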